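/- Let $f:\mathbb{R}^n\to\mathbb{R}$ and $g:\mathbb{R}^m\to\mathbb{R}$ be convex and twice continuously differentiable, let $K:\mathbb{R}^n\to\mathbb{R}^m$ be linear, and put $\mathcal{L}(x,y)=f(x)+\langle Kx,y\rangle-g(y)$. A saddle point of $\mathcal L$ is a pair $(x^*,y^*)$ with $\mathcal{L}(x^*,y)\le\mathcal{L}(x^*,y^*)\le\mathcal{L}(x,y^*)$ for all $(x,y)\in\mathbb{R}^n\times\mathbb{R}^m$. Assume that the set $\Omega$ of saddle points is non-empty, and let $(\bar x^*,\bar y^*)=\mathrm{Proj}_\Omega 0$ be the saddle point of minimal norm, where $\|(x,y)\|=\sqrt{\|x\|^2+\|y\|^2}$. Let $\alpha>1$, $0<q<1$, $\gamma>0$, $s>0$, $c>0$, let $t_0>0$ satisfy $t_0>(\gamma q)^{1/(s+1)}$, and suppose that $$0<p<1,\qquad p-2q-s<0,\qquad 4q+s+p-2<0,\qquad 3q+s-p-1<0 .$$ For $t\ge t_0$ put $\mathcal{L}_t(x,y)=\mathcal{L}(x,y)+\frac{c}{2t^p}\left(\|x\|^2-\|y\|^2\right)$ and $$\theta(t)=\frac{t^{2q+s}-2\gamma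 q\,t^{2q-1}+\gamma t^q}{(\alpha-1)\left(t^{q+s}-\gamma q\,t^{q-1}\right)} .$$ Let $(x,y):[t_0,+\infty)\to\mathbb{R}^n\times\mathbb{R}^m$ be a (twice differentiable) global solution of the system $$\ddot x(t)+\frac{\alpha}{t^q}\dot x(t)+\gamma\frac{d}{dt}\Big(\nabla_x\mathcal{L}_t\big(x(t),y(t)+\theta(t)\dot y(t)\big)\Big)+t^s\,\nabla_x\mathcal{L}_t\big(x(t),y(t)+\theta(t)\dot y(t)\big)=0,$$ $$\ddot y(t)+\frac{\alpha}{t^q}\dot y(t)-\gamma\frac{d}{dt}\Big(\nabla_y\mathcal{L}_t\big(x(t)+\theta(t)\dot x(t),y(t)\big)\Big)-t^s\,\nabla_y\mathcal{L}_t\big(x(t)+\theta(t)\dot x(t),y(t)\big)=0 .$$ Then, as $t\to+\infty$: (i) if $q+2p\ge 1$, then $\displaystyle \mathcal{L}(x(t),\bar y^*)-\mathcal{L}(\bar x^*,y(t))=\mathcal{O}\left(\frac{1}{t^{1-2q-\frac12(s+p)}}+\frac{1}{t^p}\right)$; (ii) if $q+2p<1$, then $\displaystyle \mathcal{L}(x(t),\bar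 y^*)-\mathcal{L}(\bar x^*,y(t))=\mathcal{O}\left(\frac{1}{t^{\frac12(1+p-s)-\frac32 q}}+\frac{1}{t^p}\right)$. -/

import Mathlib

open Filter Topology Asymptotics Set

noncomputable section

namespace SaddleFlow

variable {n m : ℕ}

/-- The convex-concave function `L(x, y) = f(x) + ⟨K x, y⟩ - g(y)`. -/
def lagrangian (K : EuclideanSpace ℝ (Fin n) →L[ℝ] EuclideanSpace ℝ (Fin m))
    (f : EuclideanSpace ℝ (Fin n) → ℝ) (g : EuclideanSpace ℝ (Fin m) → ℝ)
    (x : EuclideanSpace ℝ (Fin n)) (y : EuclideanSpace ℝ (Fin m)) : ℝ :=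
  f x + inner ℝ (K x) y - g y

/-- The Tikhonov-regularized function
`L_t(x, y) = L(x, y) + c / (2 t ^ p) * (‖x‖ ^ 2 - ‖y‖ ^ 2)`. -/
def augLagrangian (c p : ℝ)
    (K : EuclideanSpace ℝ (Fin n) →L[ℝ] EuclideanSpace ℝ (Fin m))
    (f : EuclideanSpace ℝ (Fin n) → ℝ) (g : EuclideanSpace ℝ (Fin m) → ℝ) (t : ℝ)
    (x : EuclideanSpace ℝ (Fin n)) (y : EuclideanSpace ℝ (Fin m)) : ℝ :=
  lagrangian K f g x y + c / (2 * t ^ p) * (‖x‖ ^ 2 - ‖y‖ ^ 2)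

/-- The partial gradient `∇ₓ L_t(x, y)`. -/
def gradX (c p : ℝ)
    (K : EuclideanSpace ℝ (Fin n) →L[ℝ] EuclideanSpace ℝ (Fin m))
    (f : EuclideanSpace ℝ (Fin n) → ℝ) (g : EuclideanSpace ℝ (Fin m) → ℝ) (t : ℝ)
    (x : EuclideanSpace ℝ (Fin n)) (y : EuclideanSpace ℝ (Fin m)) : EuclideanSpace ℝ (Fin n) :=
  gradient (fun x' => augLagrangian c p K f g t x' y) x

/-- The partial gradient `∇_y L_t(x, y)`. -/
def gradY (c p : ℝ)
    (K : EuclideanSpace ℝ (Fin n) →L[ℝ] EuclideanSpace ℝ (Fin m))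
    (f : EuclideanSpace ℝ (Fin n) → ℝ) (g : EuclideanSpace ℝ (Fin m) → ℝ) (t : ℝ)
    (x : EuclideanSpace ℝ (Fin n)) (y : EuclideanSpace ℝ (Fin m)) : EuclideanSpace ℝ (Fin m) :=
  gradient (fun y' => augLagrangian c p K f g t x y') y

/-- The extrapolation parameter `θ(t)`. -/
def theta (α γ q s t : ℝ) : ℝ :=
  (t ^ (2 * q + s) - 2 * γ * q * t ^ (2 * q - 1) + γ * t ^ q) /
    ((α - 1) * (t ^ (q + s) - γ * q * t ^ (q - 1)))

/-- The set `Ω` of saddle points of `L`, in the product space with the norm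
`‖(x, y)‖ = √(‖x‖ ^ 2 + ‖y‖ ^ 2)`. -/
def saddleSet (K : EuclideanSpace ℝ (Fin n) →L[ℝ] EuclideanSpace ℝ (Fin m))
    (f : EuclideanSpace ℝ (Fin n) → ℝ) (g : EuclideanSpace ℝ (Fin m) → ℝ) :
    Set (WithLp 2 (EuclideanSpace ℝ (Fin n) × EuclideanSpace ℝ (Fin m))) :=
  {z | ∀ (x : EuclideanSpace ℝ (Fin n)) (y : EuclideanSpace ℝ (Fin m)),
    lagrangian K f g z.fst y ≤ lagrangian K f g z.fst z.snd ∧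
      lagrangian K f g z.fst z.snd ≤ lagrangian K f g x z.snd}

/-- `Proj_D 0`: the points of `D` that are closest to the origin. -/
def projZero {E : Type*} [NormedAddCommGroup E] (D : Set E) : Set E :=
  {z | z ∈ D ∧ ∀ w ∈ D, ‖z‖ ≤ ‖w‖}

/-- `(x, y)` is a global solution on `[t₀, ∞)` of the Tikhonov-regularized second-order
primal-dual system. Derivatives are taken within `[t₀, ∞)`, hence one-sided at `t₀`. -/
structure IsGlobalSolution (α γ q s c p t₀ : ℝ)
    (K : EuclideanSpace ℝ (Fin n) →L[ℝ] EuclideanSpace ℝ (Fin m))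
    (f : EuclideanSpace ℝ (Fin n) → ℝ) (g : EuclideanSpace ℝ (Fin m) → ℝ)
    (x : ℝ → EuclideanSpace ℝ (Fin n)) (y : ℝ → EuclideanSpace ℝ (Fin m)) : Prop where
  diff_x : DifferentiableOn ℝ x (Ici t₀)
  diff_y : DifferentiableOn ℝ y (Ici t₀)
  diff_dx : DifferentiableOn ℝ (derivWithin x (Ici t₀)) (Ici t₀)
  diff_dy : DifferentiableOn ℝ (derivWithin y (Ici t₀)) (Ici t₀)
  eq_x : ∀ t ∈ Ici t₀,
    derivWithin (derivWithin x (Ici t₀)) (Ici t₀) t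
      + (α / t ^ q) • derivWithin x (Ici t₀) t
      + γ • derivWithin
          (fun τ => gradX c p K f g τ (x τ)
            (y τ + theta α γ q s τ • derivWithin y (Ici t₀) τ)) (Ici t₀) t
      + t ^ s • gradX c p K f g t (x t)
          (y t + theta α γ q s t • derivWithin y (Ici t₀) t) = 0
  eq_y : ∀ t ∈ Ici t₀,
    derivWithin (derivWithin y (Ici t₀)) (Ici t₀) t
      + (α / t ^ q) • derivWithin y (Ici t₀) t
      - γ • derivWithin
          (fun τ => gradY c p K f g τ
            (x τ + theta α γ q s τ • derivWithin x (Ici t₀) τ) (y τ)) (Ici t₀) t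
      - t ^ s • gradY c p K f g t
          (x t + theta α γ q s t • derivWithin x (Ici t₀) t) (y t) = 0

end SaddleFlow

end

/-! Put `z = (x, y)` in the product Hilbert space, `φ(x, y) = f x + g y`, `A = ∇φ`, and let `J` be
the skew map `(x, y) ↦ (K† y, -K x)`. Both equations merge into one: the momentum `ż + γ W` has
derivative `-(α / t^q) ż - t^s W`, where `W = A z + J (z + θ ż) + (c / t^p) z`. Saddle points are
the zeros of the monotone field `A + J`, and the primal-dual gap at a saddle point is `gap` with
parameter `0`.

The Tikhonov term makes the field strongly monotone, so at each time it has a single zero `ζ(t)`.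
This curve satisfies `‖ζ‖ ≤ R` and `‖ζ'‖ ≤ p R / t`, with `R` the norm of the given saddle point
(`exists_isRegularizedPath`). The trajectory is compared with this moving target through the
Lyapunov function `energy`. Its weights and `θ` are matched so that the indefinite cross terms
cancel (`hasDerivAt_energy`). The remaining errors come from the motion of `ζ` and the time
dependence of the weights, and `energy_absorption` leaves `E' ≤ -k t^(-q) E + C t^(-q-r)` with `r =
2 - 4q - s - p`. A Grönwall argument gives `E = O(t^(-r))`, hence `‖z - ζ‖ = O(t^(-r/2))`.

Finally, convexity bounds the gap at `z` by the gap at `ζ`, which is `O(t^(-p))`, plus a constant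
times `‖z - ζ‖` (`gap_zero_isBigO`). This is the rate in (i). It is proved in both regimes; when `q
+ 2p < 1` it is stronger than the rate in (ii). -/

namespace SaddleFlow

/-! ### Monotone fields and the curve of regularized zeros. -/

section Monotone

variable {Z : Type*} [NormedAddCommGroup Z] [InnerProductSpace ℝ Z]

theorem _root_.ConvexOn.add_inner_gradient_le [CompleteSpace Z] {φ : Z → ℝ} {A : Z → Z}
    (hconv : ConvexOn ℝ univ φ) (hA : ∀ z, HasGradientAt φ (A z) z) (z w : Z) :
    φ z + inner ℝ (A z) (w - z) ≤ φ w := by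
  have hline : HasDerivAt (fun τ : ℝ => φ (z + τ • (w - z))) (inner ℝ (A z) (w - z)) 0 := by
    have h1 : HasDerivAt (fun τ : ℝ => z + τ • (w - z)) (w - z) 0 := by
      simpa using ((hasDerivAt_id (0 : ℝ)).smul_const (w - z)).const_add z
    have h2 : HasFDerivAt φ (InnerProductSpace.toDual ℝ Z (A z)) (z + (0 : ℝ) • (w - z)) := by
      simpa using (hA z).hasFDerivAt
    exact h2.comp_hasDerivAt 0 h1
  have hc : ConvexOn ℝ univ (fun τ : ℝ => φ (z + τ • (w - z))) := by
    have := hconv.comp_affineMap (AffineMap.lineMap z w : ℝ →ᵃ[ℝ] Z)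
    refine (this.congr ?_)
    intro τ _
    simp [AffineMap.lineMap_apply, add_comm]
  have := hc.le_slope_of_hasDerivAt (mem_univ 0) (mem_univ 1) one_pos hline
  simp [slope_def_field] at this
  linarith

theorem inner_gradient_sub_nonneg [CompleteSpace Z] {φ : Z → ℝ} {A : Z → Z}
    (hconv : ConvexOn ℝ univ φ) (hA : ∀ z, HasGradientAt φ (A z) z) (z w : Z) :
    0 ≤ inner ℝ (A z - A w) (z - w) := by
  have h1 := hconv.add_inner_gradient_le hA z w
  have h2 := hconv.add_inner_gradient_le hA w z
  have h3 : inner ℝ (A z) (w - z) = -inner ℝ (A z) (z - w) := by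
    rw [← inner_neg_right, neg_sub]
  rw [inner_sub_left]
  linarith

/-- A strongly monotone map expands distances. -/
theorem mul_norm_sub_le_of_inner {F : Z → Z} {l : ℝ}
    (hF : ∀ z w, l * ‖z - w‖ ^ 2 ≤ inner ℝ (F z - F w) (z - w)) (z w : Z) :
    l * ‖z - w‖ ≤ ‖F z - F w‖ := by
  rcases eq_or_ne (z - w) 0 with h | h
  · simp [h]
  · have hpos : 0 < ‖z - w‖ := norm_pos_iff.2 h
    refine le_of_mul_le_mul_right ?_ hpos
    calc l * ‖z - w‖ * ‖z - w‖ = l * ‖z - w‖ ^ 2 := by ring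
      _ ≤ _ := hF z w
      _ ≤ _ := real_inner_le_norm _ _

theorem mul_norm_le_norm_fderiv {F : Z → Z} {l : ℝ}
    (hF : ∀ z w, l * ‖z - w‖ ≤ ‖F z - F w‖) {F' : Z →L[ℝ] Z} {z : Z}
    (hd : HasFDerivAt F F' z) (h : Z) : l * ‖h‖ ≤ ‖F' h‖ := by
  have h1 : HasDerivAt (fun τ : ℝ => F (z + τ • h)) (F' h) 0 := by
    have h1 : HasDerivAt (fun τ : ℝ => z + τ • h) h 0 := by
      simpa using ((hasDerivAt_id (0 : ℝ)).smul_const h).const_add z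
    have h2 : HasFDerivAt F F' (z + (0 : ℝ) • h) := by simpa using hd
    exact h2.comp_hasDerivAt 0 h1
  have h2 := h1.tendsto_slope.norm
  refine ge_of_tendsto h2 ?_
  filter_upwards [self_mem_nhdsWithin] with τ hτ
  have hτ' : τ ≠ 0 := hτ
  have := hF (z + τ • h) z
  rw [slope_def_module, norm_smul]
  simp only [sub_zero, zero_smul, add_zero, norm_inv]
  rw [add_sub_cancel_left, norm_smul] at this
  rw [inv_mul_eq_div, le_div_iff₀ (norm_pos_iff.2 hτ')]
  linarith

/-- The derivative of an expanding map of a finite-dimensional space is invertible. -/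
theorem exists_equiv_hasStrictFDerivAt [FiniteDimensional ℝ Z] {F : Z → Z} {l : ℝ} (hl : 0 < l)
    (hF : ∀ z w, l * ‖z - w‖ ≤ ‖F z - F w‖) (hC : ContDiff ℝ 1 F) (z : Z) :
    ∃ F' : Z ≃L[ℝ] Z, HasStrictFDerivAt F (F' : Z →L[ℝ] Z) z := by
  have hs := hC.contDiffAt.hasStrictFDerivAt (x := z) one_ne_zero
  have hinj : Function.Injective (fderiv ℝ F z : Z →ₗ[ℝ] Z) := by
    rw [injective_iff_map_eq_zero]
    intro h hh
    have := mul_norm_le_norm_fderiv hF hs.hasFDerivAt h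
    have h0 : fderiv ℝ F z h = 0 := hh
    rw [h0, norm_zero] at this
    exact norm_le_zero_iff.1 (nonpos_of_mul_nonpos_right this hl)
  refine ⟨(LinearEquiv.ofInjectiveEndo _ hinj).toContinuousLinearEquiv, ?_⟩
  convert hs using 1
  ext
  rfl

/-- A continuously differentiable expanding map of a finite-dimensional space is onto. -/
theorem surjective_of_expanding [FiniteDimensional ℝ Z] {F : Z → Z} {l : ℝ} (hl : 0 < l)
    (hF : ∀ z w, l * ‖z - w‖ ≤ ‖F z - F w‖) (hC : ContDiff ℝ 1 F) :
    Function.Surjective F := by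
  have : ProperSpace Z := FiniteDimensional.proper ℝ Z
  have : CompleteSpace Z := FiniteDimensional.complete ℝ Z
  rw [← range_eq_univ]
  -- The range is closed because an expanding continuous map is proper, and open by the inverse
  -- function theorem; connectedness then makes it the whole space.
  refine IsClopen.eq_univ ⟨?_, ?_⟩ (range_nonempty F)
  · have hanti : AntilipschitzWith (Real.toNNReal l⁻¹) F := by
      refine AntilipschitzWith.of_le_mul_dist fun z w => ?_
      rw [dist_eq_norm, dist_eq_norm, Real.coe_toNNReal _ (inv_pos.2 hl).le, inv_mul_eq_div,
        le_div_iff₀ hl]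
      linarith [hF z w]
    have hp : IsProperMap F := by
      rw [isProperMap_iff_tendsto_cocompact]
      refine ⟨hC.continuous, ?_⟩
      have := hanti.tendsto_cobounded
      rwa [Metric.cobounded_eq_cocompact] at this
    exact hp.isClosedMap.isClosed_range
  · rw [isOpen_iff_mem_nhds]
    rintro _ ⟨z, rfl⟩
    obtain ⟨F', hF'⟩ := exists_equiv_hasStrictFDerivAt hl hF hC z
    rw [← hF'.map_nhds_eq_of_equiv]
    exact mem_map.2 (univ_mem' fun w => mem_range_self w)

/-- The zeros of `T + l • id`, for a monotone `C¹` map `T`, form a differentiable curve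
in the parameter `l > 0`. -/
theorem exists_regularized_zero [FiniteDimensional ℝ Z] {T : Z → Z}
    (hT : ∀ z w, 0 ≤ inner ℝ (T z - T w) (z - w)) (hC : ContDiff ℝ 1 T) {zbar : Z}
    (hbar : T zbar = 0) :
    ∃ (Y Y' : ℝ → Z), ∀ l, 0 < l →
      T (Y l) + l • Y l = 0 ∧ ‖Y l‖ ≤ ‖zbar‖ ∧ HasDerivAt Y (Y' l) l ∧
        ‖Y' l‖ ≤ ‖zbar‖ / l := by
  have hmono : ∀ l : ℝ, ∀ z w, l * ‖z - w‖ ^ 2 ≤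
      inner ℝ ((T z + l • z) - (T w + l • w)) (z - w) := by
    intro l z w
    have h : (T z + l • z) - (T w + l • w) = (T z - T w) + l • (z - w) := by
      rw [smul_sub]; abel
    rw [h, inner_add_left, real_inner_smul_left, real_inner_self_eq_norm_sq]
    linarith [hT z w]
  have hexp : ∀ l : ℝ, ∀ z w, l * ‖z - w‖ ≤ ‖(T z + l • z) - (T w + l • w)‖ := fun l =>
    mul_norm_sub_le_of_inner (F := fun z => T z + l • z) (hmono l)
  have hCl : ∀ l : ℝ, ContDiff ℝ 1 (fun z => T z + l • z) := fun l =>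
    hC.add (contDiff_const_smul l)
  have hsurj : ∀ l : ℝ, 0 < l → Function.Surjective (fun z => T z + l • z) := fun l hl =>
    surjective_of_expanding hl (hexp l) (hCl l)
  have hex : ∀ l : ℝ, ∃ z, 0 < l → T z + l • z = 0 := by
    intro l
    by_cases hl : 0 < l
    · obtain ⟨z, hz⟩ := hsurj l hl 0
      exact ⟨z, fun _ => hz⟩
    · exact ⟨0, fun h => absurd h hl⟩
  choose Y hY using hex
  -- Monotonicity between `Y l` and `zbar` gives `l ⟨Y l, Y l - zbar⟩ ≤ 0`, that is `‖Y l‖² ≤ ⟨Y l,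
  -- zbar⟩`.
  have hbound : ∀ l, 0 < l → ‖Y l‖ ≤ ‖zbar‖ := by
    intro l hl
    have h1 := hT (Y l) zbar
    rw [hbar, sub_zero, eq_neg_of_add_eq_zero_left (hY l hl), inner_neg_left,
      real_inner_smul_left, inner_sub_right, real_inner_self_eq_norm_sq] at h1
    have h2 := real_inner_le_norm (Y l) zbar
    have h3 : ‖Y l‖ ^ 2 ≤ ‖Y l‖ * ‖zbar‖ := by
      by_contra hcon
      push Not at hcon
      nlinarith
    by_contra hcon
    push Not at hcon
    nlinarith [norm_nonneg (Y l), norm_nonneg zbar]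
  have hshift : ∀ l m, 0 < m → T (Y m) + l • Y m = (l - m) • Y m := by
    intro l m hm
    rw [eq_neg_of_add_eq_zero_left (hY m hm), sub_smul]
    abel
  have hlip : ∀ l m, 0 < l → 0 < m → ‖Y m - Y l‖ ≤ ‖zbar‖ / l * ‖m - l‖ := by
    intro l m hl hm
    have h1 := hexp l (Y m) (Y l)
    rw [hY l hl, sub_zero, hshift l m hm, norm_smul, norm_sub_rev l m] at h1
    have h2 := mul_le_mul_of_nonneg_left (hbound m hm) (norm_nonneg (m - l))
    rw [div_mul_eq_mul_div, le_div_iff₀ hl]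
    linarith
  have hdiff : ∀ l, 0 < l → DifferentiableAt ℝ Y l := by
    intro l hl
    have hev : ∀ᶠ m in 𝓝 l, 0 < m := lt_mem_nhds hl
    have hcont : ContinuousAt Y l := by
      rw [ContinuousAt, tendsto_iff_norm_sub_tendsto_zero]
      refine squeeze_zero' (g := fun m => ‖zbar‖ / l * ‖m - l‖)
        (Eventually.of_forall fun _ => norm_nonneg _) (hev.mono fun m hm => hlip l m hl hm) ?_
      have : Continuous fun m : ℝ => ‖zbar‖ / l * ‖m - l‖ := by fun_prop
      simpa using this.tendsto l
    obtain ⟨S, hS⟩ := (hsurj l hl).hasRightInverse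
    have hinj : Function.Injective (fun z => T z + l • z) := by
      intro z w hzw
      have h1 := hexp l z w
      have h2 : T z + l • z = T w + l • w := hzw
      rw [h2, sub_self, norm_zero] at h1
      exact sub_eq_zero.1 (norm_le_zero_iff.1 (nonpos_of_mul_nonpos_right h1 hl))
    have hSl : Function.LeftInverse S (fun z => T z + l • z) := hS.leftInverse_of_injective hinj
    have hScont : Continuous S := by
      have : LipschitzWith (Real.toNNReal l⁻¹) S := by
        refine LipschitzWith.of_dist_le_mul fun z w => ?_
        rw [dist_eq_norm, dist_eq_norm, Real.coe_toNNReal _ (inv_pos.2 hl).le]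
        have h1 := hexp l (S z) (S w)
        have h2 : T (S z) + l • S z = z := hS z
        have h3 : T (S w) + l • S w = w := hS w
        rw [h2, h3] at h1
        rw [inv_mul_eq_div, le_div_iff₀ hl]
        linarith
      exact this.continuous
    have hS0 : S 0 = Y l := by
      have := hSl (Y l)
      simpa only [hY l hl] using this
    obtain ⟨F', hF'⟩ := exists_equiv_hasStrictFDerivAt hl (hexp l) (hCl l) (S 0)
    have hSd : HasFDerivAt S (F'.symm : Z →L[ℝ] Z) 0 :=
      HasFDerivAt.of_local_left_inverse hScont.continuousAt hF'.hasFDerivAt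
        (Eventually.of_forall hS)
    -- With `S` the inverse of `T + l • id`, one has `Y m = S ((l - m) • Y m)`. The factor `l - m`
    -- vanishes at `m = l`, so continuity of `Y` already makes the inner map differentiable there,
    -- and the chain rule upgrades `Y` to differentiable.
    have hd : HasDerivAt (fun m => (l - m) • Y m) (-Y l) l := by
      rw [hasDerivAt_iff_tendsto_slope]
      have h1 : Tendsto (fun m => -Y m) (𝓝[≠] l) (𝓝 (-Y l)) :=
        (hcont.neg.tendsto).mono_left nhdsWithin_le_nhds
      refine h1.congr' ?_
      filter_upwards [self_mem_nhdsWithin] with m hm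
      have hm' : m - l ≠ 0 := sub_ne_zero.2 hm
      rw [slope_def_module, sub_self, zero_smul, sub_zero, smul_smul,
        show (m - l)⁻¹ * (l - m) = -1 by field_simp; ring, neg_one_smul]
    have hSd' : HasFDerivAt S (F'.symm : Z →L[ℝ] Z) ((l - l) • Y l) := by simpa using hSd
    have hcomp := hSd'.comp_hasDerivAt l hd
    refine (hcomp.congr_of_eventuallyEq ?_).differentiableAt
    filter_upwards [hev] with m hm
    have := hSl (Y m)
    simp only [hshift l m hm] at this
    exact this.symm
  refine ⟨Y, deriv Y, fun l hl => ⟨hY l hl, hbound l hl, (hdiff l hl).hasDerivAt, ?_⟩⟩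
  refine (hdiff l hl).hasDerivAt.le_of_lip' (by positivity) ?_
  filter_upwards [lt_mem_nhds hl] with m hm
  exact hlip l m hl hm

end Monotone

end SaddleFlow

/-! ### Time-dependent coefficients and the absorption inequality. -/

namespace SaddleFlow

/-- The damping coefficient `1 - q t^(q-1)`. -/
noncomputable def etaCoeff (q t : ℝ) : ℝ := 1 - q * t ^ (q - 1)

/-- The coefficient `t^(q+s) - γ q t^(q-1)` of the regularized field in the momentum equation. -/
noncomputable def betaCoeff (γ q s t : ℝ) : ℝ := t ^ (q + s) - γ * q * t ^ (q - 1)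

/-- The weight of the Bregman gap in the energy: the numerator of `theta`. -/
noncomputable def gapWeight (γ q s t : ℝ) : ℝ :=
  t ^ (2 * q + s) - 2 * γ * q * t ^ (2 * q - 1) + γ * t ^ q

section Coefficients

variable {γ q s t : ℝ}

/-- The right side is the coefficient of `-⟨ż, W⟩` in the derivative of `½‖mixed‖²`; weighting the
gap by it allows the two contributions to cancel. -/
theorem gapWeight_eq (ht : 0 < t) :
    gapWeight γ q s t = t ^ q * betaCoeff γ q s t + γ * t ^ q * etaCoeff q t := by
  have e1 : t ^ (2 * q + s) = t ^ q * t ^ (q + s) := by rw [← Real.rpow_add ht]; ring_nf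
  have e2 : t ^ (2 * q - 1) = t ^ q * t ^ (q - 1) := by rw [← Real.rpow_add ht]; ring_nf
  rw [gapWeight, betaCoeff, etaCoeff, e1, e2]
  ring

/-- This identity is the reason for the choice of `θ`: it makes the skew coupling terms cancel in
the derivative of the energy. -/
theorem theta_mul {α : ℝ} (hα : 1 < α) (hβ : 0 < betaCoeff γ q s t) :
    (α - 1) * betaCoeff γ q s t * theta α γ q s t = gapWeight γ q s t := by
  have h : 0 < α - 1 := by linarith
  change (α - 1) * betaCoeff γ q s t * (gapWeight γ q s t / ((α - 1) * betaCoeff γ q s t)) = _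
  field_simp

theorem hasDerivAt_etaCoeff (ht : 0 < t) :
    HasDerivAt (etaCoeff q) (q * (1 - q) * t ^ (q - 2)) t := by
  have h := ((Real.hasDerivAt_rpow_const (x := t) (p := q - 1) (Or.inl ht.ne')).const_mul
    q).const_sub 1
  refine h.congr_deriv ?_
  rw [show q - 1 - 1 = q - 2 by ring]
  ring

theorem hasDerivAt_gapWeight (ht : 0 < t) :
    HasDerivAt (gapWeight γ q s) ((2 * q + s) * t ^ (2 * q + s - 1)
      - 2 * γ * q * ((2 * q - 1) * t ^ (2 * q - 2)) + γ * (q * t ^ (q - 1))) t := by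
  have h1 := Real.hasDerivAt_rpow_const (x := t) (p := 2 * q + s) (Or.inl ht.ne')
  have h2 := (Real.hasDerivAt_rpow_const (x := t) (p := 2 * q - 1) (Or.inl ht.ne')).const_mul
    (2 * γ * q)
  have h3 := (Real.hasDerivAt_rpow_const (x := t) (p := q) (Or.inl ht.ne')).const_mul γ
  have h := (h1.sub h2).add h3
  rw [show 2 * q - 1 - 1 = 2 * q - 2 by ring] at h
  exact h

theorem hasDerivAt_div_rpow (c p : ℝ) (ht : 0 < t) :
    HasDerivAt (fun t : ℝ => c / t ^ p) (-(c * p * t ^ (-p) * t⁻¹)) t := by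
  have h := (Real.hasDerivAt_rpow_const (x := t) (p := -p) (Or.inl ht.ne')).const_mul c
  have h' : HasDerivAt (fun t : ℝ => c * t ^ (-p)) (-(c * p * t ^ (-p) * t⁻¹)) t := by
    refine h.congr_deriv ?_
    rw [Real.rpow_sub_one ht.ne']
    ring
  refine h'.congr_of_eventuallyEq ?_
  filter_upwards [lt_mem_nhds ht] with u hu
  rw [Real.rpow_neg hu.le, div_eq_mul_inv]

/-- Here `P`, `S`, `τ` stand for `t^q`, `t^s`, `t⁻¹`, so that the asymptotic comparison becomes
polynomial algebra. -/
theorem coeff_bounds_of_powers {a P S τ : ℝ} (hγ : 0 < γ) (hq0 : 0 < q) (hq1 : q < 1)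
    (hP : 1 ≤ P) (hS : 1 ≤ S) (hτ0 : 0 < τ) (hτ : τ ≤ 1)
    (hqe : q * (P * τ) ≤ 1 / 2) (hγτ : γ * q * τ ≤ 1 / 4) (hγP : γ ≤ P)
    (hPτa : (2 * q + s + 3 * γ * q) * (P * τ) ≤ a / 4) (ha : 0 < a) :
    1 - q * (P * τ) ∈ Icc (1 / 2) 1 ∧ P * S / 2 ≤ P * S - γ * q * (P * τ) ∧
      P ^ 2 * S - 2 * γ * q * (P ^ 2 * τ) + γ * P ∈
        Icc (P ^ 2 * S / 2) (2 * (P ^ 2 * S)) ∧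
      (2 * q + s) * (P ^ 2 * S * τ) - 2 * γ * q * ((2 * q - 1) * (P ^ 2 * τ ^ 2))
        + γ * (q * (P * τ)) ≤ a / 2 * (P * S - γ * q * (P * τ)) := by
  have hP0 : 0 < P := by linarith
  have hS0 : 0 < S := by linarith
  have hPS : P ≤ P * S := le_mul_of_one_le_right (by linarith) hS
  have hPP : P ^ 2 ≤ P ^ 2 * S := le_mul_of_one_le_right (by positivity) hS
  have hγP2 : γ * P ≤ P ^ 2 := by
    rw [pow_two]
    exact mul_le_mul_of_nonneg_right hγP hP0.le
  have hqpos : 0 < q * (P * τ) := by positivity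
  have hβ : P * S / 2 ≤ P * S - γ * q * (P * τ) := by
    have := mul_le_mul_of_nonneg_left hγτ hP0.le
    linarith
  refine ⟨⟨by linarith, by linarith⟩, hβ, ⟨?_, ?_⟩, ?_⟩
  · have h1 := mul_le_mul_of_nonneg_left hγτ (show 0 ≤ 2 * P ^ 2 by positivity)
    have h2 : 0 < γ * P := by positivity
    linarith
  · have h1 : 0 ≤ 2 * γ * q * (P ^ 2 * τ) := by positivity
    linarith
  · have hpos : 0 < γ * q * (P ^ 2 * τ ^ 2) := by positivity
    have k1 : -(2 * γ * q * ((2 * q - 1) * (P ^ 2 * τ ^ 2))) ≤ 2 * γ * q * (P ^ 2 * τ ^ 2) := by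
      have := mul_nonneg hpos.le hq0.le
      linarith
    have k2 : P ^ 2 * τ ^ 2 ≤ P ^ 2 * S * τ := by
      have h1 : τ ≤ S := hτ.trans hS
      have := mul_le_mul_of_nonneg_left h1 (show 0 ≤ P ^ 2 * τ by positivity)
      linarith
    have k3 : P * τ ≤ P ^ 2 * S * τ := by
      have h1 : 1 ≤ P * S := hP.trans hPS
      have := mul_le_mul_of_nonneg_left h1 (show 0 ≤ P * τ by positivity)
      linarith
    have k4 := mul_le_mul_of_nonneg_left k2 (show 0 ≤ 2 * γ * q by positivity)
    have k5 := mul_le_mul_of_nonneg_left k3 (show 0 ≤ γ * q by positivity)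
    have k6 := mul_le_mul_of_nonneg_right hPτa (show 0 ≤ P * S by positivity)
    have k7 := mul_le_mul_of_nonneg_left hβ ha.le
    linarith

/-- For large `t` the coefficients are comparable to their leading powers. -/
theorem eventually_coeff_bounds {c p a : ℝ} (γ s : ℝ) (hγ : 0 < γ) (hq0 : 0 < q) (hq1 : q < 1)
    (hs : 0 < s) (hc : 0 < c) (hp1 : p < 1) (ha : 0 < a)
    (h : p - 2 * q - s < 0) :
    ∀ᶠ t : ℝ in atTop, 1 ≤ t ∧ etaCoeff q t ∈ Icc (1 / 2) 1 ∧
      t ^ q * t ^ s / 2 ≤ betaCoeff γ q s t ∧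
      gapWeight γ q s t ∈ Icc ((t ^ q) ^ 2 * t ^ s / 2) (2 * ((t ^ q) ^ 2 * t ^ s)) ∧
      (2 * q + s) * t ^ (2 * q + s - 1) - 2 * γ * q * ((2 * q - 1) * t ^ (2 * q - 2))
        + γ * (q * t ^ (q - 1)) ≤ a / 2 * betaCoeff γ q s t ∧
      1 ≤ (t ^ q) ^ 2 * t ^ s * t ^ (-p) ∧ t⁻¹ ^ 2 ≤ c / 8 * (t ^ s * t ^ (-p)) := by
  have l1 : Tendsto (fun t : ℝ => t ^ q * t⁻¹) atTop (𝓝 0) := by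
    refine (tendsto_rpow_neg_atTop (y := 1 - q) (by linarith)).congr' ?_
    filter_upwards [eventually_gt_atTop 0] with t ht
    rw [← Real.rpow_neg_one, ← Real.rpow_add ht]
    ring_nf
  have l2 : Tendsto (fun t : ℝ => t⁻¹) atTop (𝓝 0) := tendsto_inv_atTop_zero
  have l3 : Tendsto (fun t : ℝ => t ^ q) atTop atTop := tendsto_rpow_atTop hq0
  have l4 : Tendsto (fun t : ℝ => t⁻¹ ^ 2 * t ^ p) atTop (𝓝 0) := by
    refine (tendsto_rpow_neg_atTop (y := 2 - p) (by linarith)).congr' ?_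
    filter_upwards [eventually_gt_atTop 0] with t ht
    rw [← Real.rpow_neg_one, ← Real.rpow_natCast, ← Real.rpow_mul ht.le, ← Real.rpow_add ht]
    norm_num
    ring_nf
  have b1 : 0 < min (1 / (2 * q)) (a / (4 * (2 * q + s + 3 * γ * q))) := by positivity
  filter_upwards [eventually_ge_atTop 1, l1.eventually_le_const b1,
    l2.eventually_le_const (show 0 < 1 / (4 * γ * q) by positivity), l3.eventually_ge_atTop γ,
    l4.eventually_le_const (show 0 < c / 8 by positivity)] with t ht e1 e2 e3 e4
  have ht0 : 0 < t := by linarith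
  have hP : 1 ≤ t ^ q := Real.one_le_rpow ht hq0.le
  have hS : 1 ≤ t ^ s := Real.one_le_rpow ht hs.le
  have hτ : t⁻¹ ≤ 1 := inv_le_one_of_one_le₀ ht
  have hτ0 : 0 < t⁻¹ := by positivity
  have hL : t ^ p * t ^ (-p) = 1 := by rw [← Real.rpow_add ht0]; simp
  have hL0 : 0 < t ^ (-p) := by positivity
  have r1 : t ^ (q + s) = t ^ q * t ^ s := Real.rpow_add ht0 _ _
  have r2 : t ^ (q - 1) = t ^ q * t⁻¹ := by rw [Real.rpow_sub_one ht0.ne', div_eq_mul_inv]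
  have r3 : t ^ (2 * q) = (t ^ q) ^ 2 := by
    rw [← Real.rpow_natCast, ← Real.rpow_mul ht0.le]; norm_num; ring_nf
  have r4 : t ^ (2 * q + s) = (t ^ q) ^ 2 * t ^ s := by rw [Real.rpow_add ht0, r3]
  have r5 : t ^ (2 * q + s - 1) = (t ^ q) ^ 2 * t ^ s * t⁻¹ := by
    rw [Real.rpow_sub_one ht0.ne', r4, div_eq_mul_inv]
  have r6 : t ^ (2 * q - 1) = (t ^ q) ^ 2 * t⁻¹ := by
    rw [Real.rpow_sub_one ht0.ne', r3, div_eq_mul_inv]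
  have r7 : t ^ (2 * q - 2) = (t ^ q) ^ 2 * t⁻¹ ^ 2 := by
    rw [show 2 * q - 2 = 2 * q - 1 - 1 by ring, Real.rpow_sub_one ht0.ne', r6]
    ring
  have hPSL : 1 ≤ (t ^ q) ^ 2 * t ^ s * t ^ (-p) := by
    rw [← r4, ← Real.rpow_add ht0]
    exact Real.one_le_rpow ht (by linarith)
  rw [etaCoeff, betaCoeff, gapWeight, r1, r2, r4, r5, r6, r7]
  set P := t ^ q
  set S := t ^ s
  set L := t ^ (-p)
  set τ := t⁻¹
  have hqe : q * (P * τ) ≤ 1 / 2 := by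
    have := mul_le_mul_of_nonneg_left (e1.trans (min_le_left _ _)) hq0.le
    refine this.trans (le_of_eq ?_)
    field_simp
  have hγτ : γ * q * τ ≤ 1 / 4 := by
    have := mul_le_mul_of_nonneg_left e2 (show 0 ≤ γ * q by positivity)
    refine this.trans (le_of_eq ?_)
    field_simp
  have hPτa : (2 * q + s + 3 * γ * q) * (P * τ) ≤ a / 4 := by
    have := mul_le_mul_of_nonneg_left (e1.trans (min_le_right _ _))
      (show 0 ≤ 2 * q + s + 3 * γ * q by positivity)
    refine this.trans (le_of_eq ?_)
    field_simp
  obtain ⟨c1, c2, c3, c4⟩ := coeff_bounds_of_powers hγ hq0 hq1 hP hS hτ0 hτ hqe hγτ e3 hPτa ha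
  refine ⟨ht, c1, c2, c3, c4, hPSL, ?_⟩
  have h1 : τ ^ 2 ≤ c / 8 * L := by
    calc τ ^ 2 = τ ^ 2 * (t ^ p * L) := by rw [hL, mul_one]
      _ = τ ^ 2 * t ^ p * L := by ring
      _ ≤ _ := mul_le_mul_of_nonneg_right e4 hL0.le
  refine h1.trans (mul_le_mul_of_nonneg_left ?_ (by positivity))
  exact le_mul_of_one_le_left hL0.le hS

end Coefficients

/-- Absorption of the error terms in the derivative of the energy. -/
theorem energy_absorption {a γ c p R j k P S L τ β η N N' δ ω ν V G e : ℝ}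
    (ha : 0 < a) (hγ : 0 < γ) (hc : 0 < c) (hp0 : 0 < p) (hR : 0 ≤ R) (hj : 0 ≤ j)
    (hk0 : 0 < k) (hk1 : k ≤ 1 / 9) (hk2 : 9 * γ * k ≤ 1) (hk3 : 8 * k ≤ a)
    (hk4 : k * (9 * a + 1) ≤ c / 8)
    (hP : 1 ≤ P) (hS : 1 ≤ S) (hL0 : 0 < L) (hL1 : L ≤ 1) (hτ0 : 0 < τ)
    (hη : η ∈ Icc (1 / 2) 1) (hβ : P * S / 2 ≤ β) (hN : N ∈ Icc 0 (2 * (P ^ 2 * S)))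
    (hN' : N' ≤ a / 2 * β) (hPSL : 1 ≤ P ^ 2 * S * L) (hτ : τ ^ 2 ≤ c / 8 * (S * L))
    (hδ : 0 ≤ δ) (hV0 : 0 ≤ V)
    (hV : V ≤ a * δ + P * ω + γ * P * ν) (hG : 0 ≤ G)
    (he : e ≤ N' * G - a * β * (G + c * L / 2 * δ ^ 2) + N * ((j + c) * (p * R * τ) * δ)
      + a * (p * R * τ) * δ + a / 2 * (P * τ ^ 2) * δ ^ 2 + a * (p * R * τ) * V
      - P * η * ω ^ 2 - γ * P * β * ν ^ 2) :
    e ≤ -(k * P⁻¹) * (N * G + 1 / 2 * V ^ 2 + a / 2 * η * δ ^ 2)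
      + (2 * ((2 * (j + c) + a) * (p * R)) ^ 2 / (a * c) + (a * (p * R)) ^ 2 / (4 * k))
        * (P ^ 3 * S * τ ^ 2 / L) := by
  obtain ⟨hη1, hη2⟩ := hη
  obtain ⟨hN1, hN2⟩ := hN
  have hP0 : 0 < P := by linarith
  have hS0 : 0 < S := by linarith
  set B := (2 * (j + c) + a) * (p * R) with hB
  have hpR : 0 ≤ p * R := by positivity
  have hB0 : 0 ≤ B := by positivity
  have hPS0 : 0 < P * S := by positivity
  have hPS : 1 ≤ P * S := by
    have := mul_le_mul hP hS zero_le_one hP0.le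
    linarith
  have hPS1 : 1 ≤ P ^ 2 * S := by
    have := mul_le_mul hP hPS zero_le_one hP0.le
    linarith
  -- the gap terms
  have gap : N' * G - a * β * G + k * P⁻¹ * (N * G) ≤ 0 := by
    have h1 : P⁻¹ * N ≤ 4 * β := by
      rw [inv_mul_le_iff₀ hP0]
      have := mul_le_mul_of_nonneg_left hβ (show 0 ≤ 4 * P by positivity)
      linarith
    have h2 : k * (P⁻¹ * N) ≤ a / 2 * β := by
      have := mul_le_mul_of_nonneg_left h1 hk0.le
      have := mul_le_mul_of_nonneg_right hk3 (show 0 ≤ β / 2 by linarith)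
      linarith
    have h3 : N' - a * β + k * (P⁻¹ * N) ≤ 0 := by linarith
    calc _ = (N' - a * β + k * (P⁻¹ * N)) * G := by ring
      _ ≤ 0 := mul_nonpos_of_nonpos_of_nonneg h3 hG
  -- the linear terms in `δ`
  have lin : N * ((j + c) * (p * R * τ) * δ) + a * (p * R * τ) * δ
      ≤ a * c / 8 * (P * S * L) * δ ^ 2 + 2 * B ^ 2 / (a * c) * (P ^ 3 * S * τ ^ 2 / L) := by
    have h1 : N * ((j + c) * (p * R * τ) * δ) + a * (p * R * τ) * δ
        ≤ B * (P ^ 2 * S * τ) * δ := by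
      have h2 : N * ((j + c) * (p * R * τ) * δ)
          ≤ 2 * (P ^ 2 * S) * ((j + c) * (p * R * τ) * δ) :=
        mul_le_mul_of_nonneg_right hN2 (by positivity)
      have h3 : 1 * (a * (p * R * τ) * δ) ≤ P ^ 2 * S * (a * (p * R * τ) * δ) :=
        mul_le_mul_of_nonneg_right hPS1 (by positivity)
      rw [hB]
      linarith
    refine h1.trans ?_
    -- Young's inequality in the form of an exact square.
    have h4 : a * c / 8 * (P * S * L) * δ ^ 2 + 2 * B ^ 2 / (a * c) * (P ^ 3 * S * τ ^ 2 / L)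
        - B * (P ^ 2 * S * τ) * δ
        = P * S / (8 * a * c * L) * (a * c * L * δ - 4 * B * P * τ) ^ 2 := by
      field_simp
      ring
    have h5 : 0 ≤ P * S / (8 * a * c * L) * (a * c * L * δ - 4 * B * P * τ) ^ 2 := by positivity
    linarith
  -- the velocity terms
  have vel : a * (p * R * τ) * V + k * P⁻¹ * (1 / 2 * V ^ 2)
      ≤ (a * (p * R)) ^ 2 / (4 * k) * (P ^ 3 * S * τ ^ 2 / L)
        + 9 / 2 * k * (a ^ 2 * P⁻¹ * δ ^ 2 + P * ω ^ 2 + γ ^ 2 * P * ν ^ 2) := by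
    have h1 : a * (p * R * τ) * V ≤ k * P⁻¹ * V ^ 2 + (a * (p * R)) ^ 2 / (4 * k) * (P * τ ^ 2) := by
      have h2 : k * P⁻¹ * V ^ 2 + (a * (p * R)) ^ 2 / (4 * k) * (P * τ ^ 2)
          - a * (p * R * τ) * V = P⁻¹ / (4 * k) * (2 * k * V - a * (p * R) * P * τ) ^ 2 := by
        field_simp
        ring
      have h3 : 0 ≤ P⁻¹ / (4 * k) * (2 * k * V - a * (p * R) * P * τ) ^ 2 := by positivity
      linarith
    have h2 : P * τ ^ 2 ≤ P ^ 3 * S * τ ^ 2 / L := by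
      rw [le_div_iff₀ hL0]
      have h3 : L ≤ P ^ 2 * S := hL1.trans hPS1
      have := mul_le_mul_of_nonneg_left h3 (show 0 ≤ P * τ ^ 2 by positivity)
      linarith
    have h3 := mul_le_mul_of_nonneg_left h2 (show 0 ≤ (a * (p * R)) ^ 2 / (4 * k) by positivity)
    -- The coefficient `9/2` is this `3` times `3/2`: one share `k P⁻¹ V²` comes from Young's
    -- inequality and one half share from the energy itself.
    have h4 : V ^ 2 ≤ 3 * ((a * δ) ^ 2 + (P * ω) ^ 2 + (γ * P * ν) ^ 2) := by
      have h5 : V ^ 2 ≤ (a * δ + P * ω + γ * P * ν) ^ 2 := pow_le_pow_left₀ hV0 hV 2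
      linarith [sq_nonneg (a * δ - P * ω), sq_nonneg (a * δ - γ * P * ν),
        sq_nonneg (P * ω - γ * P * ν)]
    have h5 := mul_le_mul_of_nonneg_left h4 (show 0 ≤ 3 / 2 * (k * P⁻¹) by positivity)
    have h6 : 3 / 2 * (k * P⁻¹) * (3 * ((a * δ) ^ 2 + (P * ω) ^ 2 + (γ * P * ν) ^ 2))
        = 9 / 2 * k * (a ^ 2 * P⁻¹ * δ ^ 2 + P * ω ^ 2 + γ ^ 2 * P * ν ^ 2) := by
      field_simp
      ring
    linarith
  have hωt : 9 / 2 * k * (P * ω ^ 2) ≤ P * η * ω ^ 2 := by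
    have h1 : 9 / 2 * k ≤ η := by linarith
    have := mul_le_mul_of_nonneg_right h1 (show 0 ≤ P * ω ^ 2 by positivity)
    linarith
  have hνt : 9 / 2 * k * (γ ^ 2 * P * ν ^ 2) ≤ γ * P * β * ν ^ 2 := by
    have h2 : 9 / 2 * k * γ ≤ β := by linarith
    have := mul_le_mul_of_nonneg_right h2 (show 0 ≤ γ * P * ν ^ 2 by positivity)
    linarith
  -- Strong monotonicity supplies at least `(a c / 4) P S L δ²`. It is spent as `1/16` on the terms
  -- with `k`, `1/16` on the drift of `η`, and `1/8` on the linear terms (each times `a c`).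
  have hδt : 9 / 2 * k * (a ^ 2 * P⁻¹ * δ ^ 2) + k * P⁻¹ * (a / 2 * η * δ ^ 2)
      + a / 2 * (P * τ ^ 2) * δ ^ 2 + a * c / 8 * (P * S * L) * δ ^ 2
      ≤ a * β * (c * L / 2 * δ ^ 2) := by
    have h1 : P⁻¹ ≤ P * S * L := by
      rw [inv_le_iff_one_le_mul₀ hP0]
      linarith
    have h2 : 9 / 2 * k * (a ^ 2 * P⁻¹) + k * P⁻¹ * (a / 2 * η) ≤ a * c / 16 * (P * S * L) := by
      have h3 : k * P⁻¹ * (a / 2 * η) ≤ k * P⁻¹ * (a / 2) := by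
        have := mul_le_mul_of_nonneg_left hη2 (show 0 ≤ k * P⁻¹ * (a / 2) by positivity)
        linarith
      have h4 : a / 2 * P⁻¹ * (k * (9 * a + 1)) ≤ a / 2 * P⁻¹ * (c / 8) :=
        mul_le_mul_of_nonneg_left hk4 (by positivity)
      have h5 : a * c / 16 * P⁻¹ ≤ a * c / 16 * (P * S * L) :=
        mul_le_mul_of_nonneg_left h1 (by positivity)
      linarith
    have h3 : a / 2 * (P * τ ^ 2) ≤ a * c / 16 * (P * S * L) := by
      have := mul_le_mul_of_nonneg_left hτ (show 0 ≤ a / 2 * P by positivity)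
      linarith
    have h4 : a * c / 4 * (P * S * L) ≤ a * β * (c * L / 2) := by
      have := mul_le_mul_of_nonneg_left hβ (show 0 ≤ a * c * L / 2 by positivity)
      linarith
    have h5 := mul_le_mul_of_nonneg_right
      (show 9 / 2 * k * (a ^ 2 * P⁻¹) + k * P⁻¹ * (a / 2 * η) + a / 2 * (P * τ ^ 2)
        + a * c / 8 * (P * S * L) ≤ a * β * (c * L / 2) by linarith) (sq_nonneg δ)
    linarith
  linarith

end SaddleFlow

/-! ### The abstract flow, its Lyapunov function and exact derivatives. -/

namespace SaddleFlow

variable {Z : Type*} [NormedAddCommGroup Z] [InnerProductSpace ℝ Z]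

/-- Global solutions on `(t₀, ∞)` of the regularized second-order flow of the monotone field
`A + J`, with `A` a gradient and `J` skew; `W` is the regularized field along the solution. -/
structure IsRegularizedFlow (α γ q s c p t₀ : ℝ) (A : Z → Z) (J : Z →L[ℝ] Z)
    (z dz W : ℝ → Z) : Prop where
  hasDerivAt_pos : ∀ t, t₀ < t → HasDerivAt z (dz t) t
  hasDerivAt_momentum : ∀ t, t₀ < t →
    HasDerivAt (fun u => dz u + γ • W u) (-((α / t ^ q) • dz t) - t ^ s • W t) t
  field_eq : ∀ t, t₀ < t →
    W t = A (z t) + J (z t + theta α γ q s t • dz t) + (c / t ^ p) • z t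

/-- The curve of zeros of the regularized field `A + J + (c / t ^ p) • id`. -/
structure IsRegularizedPath (c p R : ℝ) (A : Z → Z) (J : Z →L[ℝ] Z) (ζ dζ : ℝ → Z) : Prop where
  zero : ∀ t, 0 < t → A (ζ t) + J (ζ t) + (c / t ^ p) • ζ t = 0
  norm_le : ∀ t, 0 < t → ‖ζ t‖ ≤ R
  hasDerivAt : ∀ t, 0 < t → HasDerivAt ζ (dζ t) t
  norm_deriv_le : ∀ t, 0 < t → ‖dζ t‖ ≤ p * R * t⁻¹

/-- The gap `L_t(x, y_t) - L_t(x_t, y)` in terms of `φ(x, y) = f x + g y` and the skew map. -/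
noncomputable def gap (φ : Z → ℝ) (J : Z →L[ℝ] Z) (l : ℝ) (z ζ : Z) : ℝ :=
  φ z - φ ζ + inner ℝ (J ζ) z + l / 2 * (‖z‖ ^ 2 - ‖ζ‖ ^ 2)

/-- The mixed variable `a (z - ζ) + t^q (ż + γ W)`. -/
noncomputable def mixed (a γ q : ℝ) (z ζ dz W : ℝ → Z) (t : ℝ) : Z :=
  a • (z t - ζ t) + t ^ q • (dz t + γ • W t)

/-- The Lyapunov function of the flow. -/
noncomputable def energy (a γ q s c p : ℝ) (φ : Z → ℝ) (J : Z →L[ℝ] Z) (z ζ dz W : ℝ → Z)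
    (t : ℝ) : ℝ :=
  gapWeight γ q s t * gap φ J (c / t ^ p) (z t) (ζ t)
    + 1 / 2 * ‖mixed a γ q z ζ dz W t‖ ^ 2 + a / 2 * etaCoeff q t * ‖z t - ζ t‖ ^ 2

/-- Reparametrize the curve of zeros by `l = c / t^p`. Since `|l'| = p l / t`, the factor `1 / l` in
the bound on its derivative cancels and only `p R / t` remains. -/
theorem exists_isRegularizedPath [FiniteDimensional ℝ Z] {c p : ℝ} (hc : 0 < c) (hp : 0 < p)
    {A : Z → Z} {J : Z →L[ℝ] Z} (hA : ContDiff ℝ 1 A)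
    (hmono : ∀ z w, 0 ≤ inner ℝ (A z - A w) (z - w))
    (hJ : ∀ u w, inner ℝ (J u) w = -inner ℝ u (J w)) {zbar : Z} (hbar : A zbar + J zbar = 0) :
    ∃ ζ dζ : ℝ → Z, IsRegularizedPath c p ‖zbar‖ A J ζ dζ := by
  have hJ0 : ∀ u, inner ℝ (J u) u = 0 := fun u => by
    have h1 := hJ u u
    rw [real_inner_comm (J u) u] at h1
    linarith
  obtain ⟨Y, Y', hY⟩ := exists_regularized_zero (T := fun z => A z + J z) (zbar := zbar)
    (fun z w => by
      have h : A z + J z - (A w + J w) = (A z - A w) + J (z - w) := by rw [map_sub]; abel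
      rw [h, inner_add_left, hJ0, add_zero]
      exact hmono z w)
    (hA.add J.contDiff) hbar
  have hpos : ∀ t : ℝ, 0 < t → 0 < c / t ^ p := fun t ht => by positivity
  refine ⟨fun t => Y (c / t ^ p), fun t => (-(c * p * t ^ (-p) * t⁻¹)) • Y' (c / t ^ p),
    fun t ht => (hY _ (hpos t ht)).1, fun t ht => (hY _ (hpos t ht)).2.1, fun t ht => ?_,
    fun t ht => ?_⟩
  · exact (hY _ (hpos t ht)).2.2.1.scomp t (hasDerivAt_div_rpow c p ht)
  · have h := (hY _ (hpos t ht)).2.2.2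
    rw [norm_smul, norm_neg, Real.norm_of_nonneg (by positivity)]
    refine (mul_le_mul_of_nonneg_left h (by positivity)).trans (le_of_eq ?_)
    rw [Real.rpow_neg ht.le]
    field_simp

section Gap

variable {φ : Z → ℝ} {A : Z → Z} {J : Z →L[ℝ] Z} {l : ℝ} {z ζ : Z}

/-- The regularized field vanishes at `ζ`, so the first-order part of the gap at `ζ` is zero and
only a Bregman distance survives. -/
theorem gap_eq_bregman (hJ : ∀ u w, inner ℝ (J u) w = -inner ℝ u (J w))
    (hζ : A ζ + J ζ + l • ζ = 0) :
    gap φ J l z ζ = φ z - φ ζ - inner ℝ (A ζ) (z - ζ) + l / 2 * ‖z - ζ‖ ^ 2 := by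
  have h0 : inner ℝ (J ζ) ζ = 0 := by
    have h1 := hJ ζ ζ
    rw [real_inner_comm (J ζ) ζ] at h1
    linarith
  have h1 : J ζ = -A ζ - l • ζ := by
    rw [← sub_eq_zero, ← hζ]
    abel
  have h2 : inner ℝ (J ζ) z = -inner ℝ (A ζ) (z - ζ) - l * inner ℝ ζ (z - ζ) := by
    have h3 : inner ℝ (J ζ) (z - ζ) = -inner ℝ (A ζ) (z - ζ) - l * inner ℝ ζ (z - ζ) := by
      conv_lhs => rw [h1]
      rw [inner_sub_left, inner_neg_left, real_inner_smul_left]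
    rw [inner_sub_right, h0, sub_zero] at h3
    exact h3
  rw [gap, h2, norm_sub_sq_real, inner_sub_right ζ, real_inner_self_eq_norm_sq,
    real_inner_comm ζ z]
  ring

theorem le_gap [CompleteSpace Z] (hconv : ConvexOn ℝ univ φ) (hφ : ∀ z, HasGradientAt φ (A z) z)
    (hJ : ∀ u w, inner ℝ (J u) w = -inner ℝ u (J w)) (hζ : A ζ + J ζ + l • ζ = 0) :
    l / 2 * ‖z - ζ‖ ^ 2 ≤ gap φ J l z ζ := by
  rw [gap_eq_bregman hJ hζ]
  linarith [hconv.add_inner_gradient_le hφ ζ z]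

/-- The tangent inequality is used at `z` here. The dissipation on the right thus controls the gap
and leaves an extra quadratic term, which later absorbs the errors. -/
theorem gap_add_le [CompleteSpace Z] (hconv : ConvexOn ℝ univ φ) (hφ : ∀ z, HasGradientAt φ (A z) z)
    (hJ : ∀ u w, inner ℝ (J u) w = -inner ℝ u (J w)) (hζ : A ζ + J ζ + l • ζ = 0) :
    gap φ J l z ζ + l / 2 * ‖z - ζ‖ ^ 2 ≤ inner ℝ (z - ζ) (A z - A ζ) + l * ‖z - ζ‖ ^ 2 := by
  rw [gap_eq_bregman hJ hζ]
  have h := hconv.add_inner_gradient_le hφ z ζ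
  rw [← neg_sub z ζ, inner_neg_right] at h
  rw [inner_sub_right (z - ζ)]
  linarith [real_inner_comm (z - ζ) (A z), real_inner_comm (z - ζ) (A ζ)]

end Gap

section Derivatives

variable {α γ q s c p t₀ R : ℝ} {φ : Z → ℝ} {A : Z → Z} {J : Z →L[ℝ] Z} {z dz W ζ dζ : ℝ → Z}
  {t : ℝ}

/-- The friction contributes `-α ż`. With the weight `a = α - 1` on `z - ζ`, only `-η ż` remains. -/
theorem hasDerivAt_mixed (ht : 0 < t) (hflow : IsRegularizedFlow α γ q s c p t₀ A J z dz W)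
    (hpath : IsRegularizedPath c p R A J ζ dζ) (ht₀ : t₀ < t) :
    HasDerivAt (mixed (α - 1) γ q z ζ dz W)
      (-(etaCoeff q t • dz t) - betaCoeff γ q s t • W t - (α - 1) • dζ t) t := by
  have h1 := ((hflow.hasDerivAt_pos t ht₀).sub (hpath.hasDerivAt t ht)).const_smul (α - 1)
  have h2 := (Real.hasDerivAt_rpow_const (x := t) (p := q) (Or.inl ht.ne')).smul
    (hflow.hasDerivAt_momentum t ht₀)
  refine (h1.add h2).congr_deriv ?_
  have e1 : t ^ q * (α / t ^ q) = α := by field_simp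
  have e2 : t ^ q * t ^ s = t ^ (q + s) := (Real.rpow_add ht _ _).symm
  have e3 : t ^ q • (-((α / t ^ q) • dz t) - t ^ s • W t) = -(α • dz t) - t ^ (q + s) • W t := by
    rw [smul_sub, smul_neg, smul_smul, smul_smul, e1, e2]
  rw [e3, etaCoeff, betaCoeff]
  module

theorem hasDerivAt_gap [CompleteSpace Z] (ht : 0 < t)
    (hJ : ∀ u w, inner ℝ (J u) w = -inner ℝ u (J w)) (hφ : ∀ z, HasGradientAt φ (A z) z)
    (hflow : IsRegularizedFlow α γ q s c p t₀ A J z dz W)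
    (hpath : IsRegularizedPath c p R A J ζ dζ) (ht₀ : t₀ < t) :
    HasDerivAt (fun t => gap φ J (c / t ^ p) (z t) (ζ t))
      (inner ℝ (A (z t) + J (ζ t) + (c / t ^ p) • z t) (dz t)
        + inner ℝ (J (dζ t)) (z t - ζ t)
        - c * p * t ^ (-p) * t⁻¹ / 2 * (‖z t‖ ^ 2 - ‖ζ t‖ ^ 2)) t := by
  have hz := hflow.hasDerivAt_pos t ht₀
  have hζ := hpath.hasDerivAt t ht
  have h1 : HasDerivAt (fun t => φ (z t)) (inner ℝ (A (z t)) (dz t)) t :=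
    (hφ (z t)).hasFDerivAt.comp_hasDerivAt t hz
  have h2 : HasDerivAt (fun t => φ (ζ t)) (inner ℝ (A (ζ t)) (dζ t)) t :=
    (hφ (ζ t)).hasFDerivAt.comp_hasDerivAt t hζ
  have h3 : HasDerivAt (fun t => J (ζ t)) (J (dζ t)) t := J.hasFDerivAt.comp_hasDerivAt t hζ
  have h4 := (h3.inner ℝ hz)
  have h5 := ((hasDerivAt_div_rpow c p ht).div_const 2).mul (hz.norm_sq.sub hζ.norm_sq)
  refine (((h1.sub h2).add h4).add h5).congr_deriv ?_
  have e1 : inner ℝ (A (ζ t)) (dζ t) = inner ℝ (J (dζ t)) (ζ t)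
      - c / t ^ p * inner ℝ (ζ t) (dζ t) := by
    have e2 : A (ζ t) = -J (ζ t) - (c / t ^ p) • ζ t := by
      rw [← sub_eq_zero, ← hpath.zero t ht]
      abel
    rw [e2, inner_sub_left, inner_neg_left, real_inner_smul_left, hJ, real_inner_comm]
    ring
  simp only [e1, Pi.sub_apply, inner_add_left, inner_sub_right, real_inner_smul_left]
  ring

/-- The third energy term cancels `⟨z - ζ, ż⟩`, and the gap term cancels `⟨ż, W⟩` up to the
dissipation. Every remaining term either has a favourable sign or involves `ζ'` or the derivative of
a scalar coefficient. -/
theorem hasDerivAt_energy [CompleteSpace Z] (hα : 1 < α) (ht : 0 < t)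
    (hJ : ∀ u w, inner ℝ (J u) w = -inner ℝ u (J w)) (hφ : ∀ z, HasGradientAt φ (A z) z)
    (hflow : IsRegularizedFlow α γ q s c p t₀ A J z dz W)
    (hpath : IsRegularizedPath c p R A J ζ dζ) (ht₀ : t₀ < t) (hβ : 0 < betaCoeff γ q s t) :
    HasDerivAt (energy (α - 1) γ q s c p φ J z ζ dz W)
      (((2 * q + s) * t ^ (2 * q + s - 1) - 2 * γ * q * ((2 * q - 1) * t ^ (2 * q - 2))
          + γ * (q * t ^ (q - 1))) * gap φ J (c / t ^ p) (z t) (ζ t)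
        - (α - 1) * betaCoeff γ q s t * (inner ℝ (z t - ζ t) (A (z t) - A (ζ t))
          + c / t ^ p * ‖z t - ζ t‖ ^ 2)
        + gapWeight γ q s t * (inner ℝ (J (dζ t)) (z t - ζ t)
          - c * p * t ^ (-p) * t⁻¹ / 2 * (‖z t‖ ^ 2 - ‖ζ t‖ ^ 2))
        - (α - 1) * etaCoeff q t * inner ℝ (z t - ζ t) (dζ t)
        + (α - 1) / 2 * (q * (1 - q) * t ^ (q - 2)) * ‖z t - ζ t‖ ^ 2
        - (α - 1) * inner ℝ (mixed (α - 1) γ q z ζ dz W t) (dζ t)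
        - t ^ q * etaCoeff q t * ‖dz t‖ ^ 2
        - γ * t ^ q * betaCoeff γ q s t * ‖W t‖ ^ 2) t := by
  have h1 := (hasDerivAt_gapWeight (γ := γ) (q := q) (s := s) ht).mul
    (hasDerivAt_gap ht hJ hφ hflow hpath ht₀)
  have h2 := ((hasDerivAt_mixed ht hflow hpath ht₀).norm_sq).const_mul (1 / 2)
  have h3 := ((hasDerivAt_etaCoeff (q := q) ht).const_mul ((α - 1) / 2)).mul
    ((hflow.hasDerivAt_pos t ht₀).sub (hpath.hasDerivAt t ht)).norm_sq
  refine ((h1.add h2).add h3).congr_deriv ?_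
  have hθ : (α - 1) * betaCoeff γ q s t * theta α γ q s t = gapWeight γ q s t := theta_mul hα hβ
  have hW := hflow.field_eq t ht₀
  have hAζ : A (ζ t) = -J (ζ t) - (c / t ^ p) • ζ t := by
    rw [← sub_eq_zero, ← hpath.zero t ht]
    abel
  -- By `hθ` the extrapolation contributes `N ⟨z - ζ, J ż⟩`, with `N` the gap weight. By skewness
  -- this and `N ⟨ż, J z⟩` add up to `N ⟨J ζ, ż⟩`, the term in the derivative of the gap.
  have key : (α - 1) * betaCoeff γ q s t * inner ℝ (z t - ζ t) (W t)
      + gapWeight γ q s t * inner ℝ (dz t) (W t)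
      = (α - 1) * betaCoeff γ q s t * (inner ℝ (z t - ζ t) (A (z t) - A (ζ t))
          + c / t ^ p * ‖z t - ζ t‖ ^ 2)
        + gapWeight γ q s t * inner ℝ (A (z t) + J (ζ t) + (c / t ^ p) • z t) (dz t) := by
    have hz0 : inner ℝ (z t) (J (z t)) = 0 := by
      have := hJ (z t) (z t)
      rw [real_inner_comm] at this
      linarith
    have hζ0 : inner ℝ (ζ t) (J (ζ t)) = 0 := by
      have := hJ (ζ t) (ζ t)
      rw [real_inner_comm] at this
      linarith
    have hd0 : inner ℝ (dz t) (J (dz t)) = 0 := by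
      have := hJ (dz t) (dz t)
      rw [real_inner_comm] at this
      linarith
    have e1 : inner ℝ (z t) (J (ζ t)) = -inner ℝ (ζ t) (J (z t)) := by
      rw [← hJ, real_inner_comm]
    have e2 : inner ℝ (dz t) (J (z t)) = -inner ℝ (z t) (J (dz t)) := by
      rw [← hJ, real_inner_comm]
    have e3 : inner ℝ (dz t) (J (ζ t)) = -inner ℝ (ζ t) (J (dz t)) := by
      rw [← hJ, real_inner_comm]
    have e4 := real_inner_comm (dz t) (A (z t))
    have e5 := real_inner_comm (dz t) (J (ζ t))
    have e6 := real_inner_comm (dz t) (z t)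
    have e7 := real_inner_comm (ζ t) (z t)
    rw [hW, hAζ, norm_sub_sq_real]
    simp only [map_add, map_smul, inner_add_left, inner_add_right, inner_sub_left,
      inner_sub_right, inner_neg_right, real_inner_smul_left, real_inner_smul_right,
      real_inner_self_eq_norm_sq, hz0, hζ0, hd0, e1, e2, e3, e4, e5, e6, e7]
    rw [← hθ]
    ring
  have hmix : inner ℝ (mixed (α - 1) γ q z ζ dz W t)
      (-(etaCoeff q t • dz t) - betaCoeff γ q s t • W t - (α - 1) • dζ t)
      = -(α - 1) * etaCoeff q t * inner ℝ (z t - ζ t) (dz t)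
        - ((α - 1) * betaCoeff γ q s t * inner ℝ (z t - ζ t) (W t)
          + gapWeight γ q s t * inner ℝ (dz t) (W t))
        - t ^ q * etaCoeff q t * ‖dz t‖ ^ 2 - γ * t ^ q * betaCoeff γ q s t * ‖W t‖ ^ 2
        - (α - 1) * inner ℝ (mixed (α - 1) γ q z ζ dz W t) (dζ t) := by
    rw [inner_sub_right _ _ ((α - 1) • dζ t), real_inner_smul_right, gapWeight_eq ht]
    congr 1
    rw [mixed]
    simp only [inner_add_left, inner_sub_right, inner_neg_right, real_inner_smul_left,
      real_inner_smul_right, real_inner_self_eq_norm_sq, real_inner_comm (dz t) (W t)]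
    ring
  rw [hmix, key]
  simp only [Pi.sub_apply, inner_sub_right (z t - ζ t) (dz t)]
  ring

end Derivatives

end SaddleFlow

/-! ### Decay of the energy and of the primal-dual gap. -/

namespace SaddleFlow

/-- A Grönwall-type estimate with polynomially vanishing damping and source. -/
theorem eventually_le_rpow_of_deriv_le {E : ℝ → ℝ} {k C q r : ℝ} (hk : 0 < k) (hq : q < 1)
    (hE : ∀ᶠ t in atTop, ∃ e, HasDerivAt E e t ∧ e ≤ -(k * t ^ (-q)) * E t + C * t ^ (-q - r)) :
    ∃ M, 0 ≤ M ∧ ∀ᶠ t in atTop, E t ≤ M * t ^ (-r) := by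
  have l1 : Tendsto (fun t : ℝ => r * t ^ (-(1 - q))) atTop (𝓝 (r * 0)) :=
    (tendsto_rpow_neg_atTop (y := 1 - q) (by linarith)).const_mul r
  rw [mul_zero] at l1
  obtain ⟨T, hT⟩ := eventually_atTop.1 ((hE.and (l1.eventually_le_const (half_pos hk))).and
    (eventually_ge_atTop 1))
  have hT1 : 1 ≤ T := (hT T le_rfl).2
  have hT0 : 0 < T := by linarith
  -- The first entry lets half of the damping dominate the source, the other half covering the decay
  -- of `t^(-r)` for `t ≥ T`; the second gives the comparison at `T`.
  set M := max (max (2 * C / k) (E T * T ^ r)) 0 with hM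
  have hM0 : 0 ≤ M := le_max_right _ _
  have hMC : 2 * C / k ≤ M := (le_max_left _ _).trans (le_max_left _ _)
  have hME : E T * T ^ r ≤ M := (le_max_right _ _).trans (le_max_left _ _)
  refine ⟨M, hM0, ?_⟩
  -- The exponential is the integrating factor of the damping `k t^(-q)`, so `H` is nonincreasing
  -- and starts nonpositive.
  set H : ℝ → ℝ := fun t => Real.exp (k / (1 - q) * t ^ (1 - q)) * (E t - M * t ^ (-r)) with hH
  have hderiv : ∀ t, T ≤ t → ∃ d, HasDerivAt H d t ∧ d ≤ 0 := by
    intro t ht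
    obtain ⟨⟨⟨e, he, hle⟩, hr⟩, -⟩ := hT t ht
    have ht0 : 0 < t := by linarith
    have h1 : HasDerivAt (fun t : ℝ => Real.exp (k / (1 - q) * t ^ (1 - q)))
        (Real.exp (k / (1 - q) * t ^ (1 - q)) * (k * t ^ (-q))) t := by
      have h2 := ((Real.hasDerivAt_rpow_const (x := t) (p := 1 - q)
        (Or.inl ht0.ne')).const_mul (k / (1 - q))).exp
      refine h2.congr_deriv ?_
      have : 1 - q ≠ 0 := by linarith
      rw [show 1 - q - 1 = -q by ring]
      field_simp
    have h2 := he.sub ((Real.hasDerivAt_rpow_const (x := t) (p := -r)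
      (Or.inl ht0.ne')).const_mul M)
    refine ⟨_, h1.mul h2, ?_⟩
    have e1 : t ^ (-r - 1) = t ^ (-q - r) * t ^ (-(1 - q)) := by
      rw [← Real.rpow_add ht0]; ring_nf
    have e2 : t ^ (-q - r) = t ^ (-q) * t ^ (-r) := by
      rw [← Real.rpow_add ht0]; ring_nf
    have h3 : M * (r * t ^ (-(1 - q))) ≤ M * (k / 2) := mul_le_mul_of_nonneg_left hr hM0
    have h4 : C ≤ M * k / 2 := by
      rw [div_le_iff₀ hk] at hMC
      linarith
    have h5 : t ^ (-q - r) * (C + M * (r * t ^ (-(1 - q))) - k * M) ≤ 0 :=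
      mul_nonpos_of_nonneg_of_nonpos (by positivity) (by linarith)
    have h6 : k * t ^ (-q) * (E t - M * t ^ (-r)) + (e - M * (-r * t ^ (-r - 1))) ≤ 0 := by
      rw [e1]
      rw [e2] at hle h5 ⊢
      linarith
    have h7 := mul_nonpos_of_nonneg_of_nonpos
      (Real.exp_pos (k / (1 - q) * t ^ (1 - q))).le h6
    linarith
  have hanti : AntitoneOn H (Ici T) := by
    refine antitoneOn_of_deriv_nonpos (convex_Ici T) ?_ ?_ ?_
    · intro t ht
      obtain ⟨d, hd, -⟩ := hderiv t ht
      exact hd.continuousAt.continuousWithinAt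
    · intro t ht
      obtain ⟨d, hd, -⟩ := hderiv t (interior_subset ht)
      exact hd.differentiableAt.differentiableWithinAt
    · intro t ht
      obtain ⟨d, hd, hd0⟩ := hderiv t (interior_subset ht)
      rwa [hd.deriv]
  have hHT : H T ≤ 0 := by
    refine mul_nonpos_of_nonneg_of_nonpos (Real.exp_pos _).le ?_
    have h1 : E T * T ^ r * T ^ (-r) ≤ M * T ^ (-r) :=
      mul_le_mul_of_nonneg_right hME (by positivity)
    rw [mul_assoc, ← Real.rpow_add hT0, add_neg_cancel, Real.rpow_zero, mul_one] at h1
    linarith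
  filter_upwards [eventually_ge_atTop T] with t ht
  have h1 : H t ≤ 0 := (hanti self_mem_Ici ht ht).trans hHT
  have h2 := nonpos_of_mul_nonpos_right h1 (Real.exp_pos _)
  linarith

/-- In `energy_absorption` these bounds serve, in order, the `ω`, `ν`, gap and `δ` terms. -/
theorem exists_damping_rate {a γ c : ℝ} (hγ : 0 < γ) (hc : 0 < c) (ha : 0 < a) :
    ∃ k : ℝ, 0 < k ∧ k ≤ 1 / 9 ∧ 9 * γ * k ≤ 1 ∧ 8 * k ≤ a ∧ k * (9 * a + 1) ≤ c / 8 := by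
  refine ⟨min (min (1 / 9) (1 / (9 * γ))) (min (a / 8) (c / 8 / (9 * a + 1))), by positivity,
    (min_le_left _ _).trans (min_le_left _ _), ?_, ?_, ?_⟩
  · rw [mul_comm, ← le_div_iff₀ (by positivity)]
    exact (min_le_left _ _).trans (min_le_right _ _)
  · rw [mul_comm, ← le_div_iff₀ (by positivity)]
    exact (min_le_right _ _).trans (min_le_left _ _)
  · rw [← le_div_iff₀ (by positivity)]
    exact (min_le_right _ _).trans (min_le_right _ _)

variable {Z : Type*} [NormedAddCommGroup Z] [InnerProductSpace ℝ Z] [CompleteSpace Z]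
  {α γ q s c p t₀ R : ℝ} {φ : Z → ℝ} {A : Z → Z} {J : Z →L[ℝ] Z} {z dz W ζ dζ : ℝ → Z}

theorem eventually_energy_deriv_le (hα : 1 < α) (hγ : 0 < γ) (hq0 : 0 < q) (hq1 : q < 1)
    (hs : 0 < s) (hc : 0 < c) (hp0 : 0 < p) (hp1 : p < 1) (h1 : p - 2 * q - s < 0)
    (hR : 0 ≤ R) (hconv : ConvexOn ℝ univ φ) (hφ : ∀ z, HasGradientAt φ (A z) z)
    (hJ : ∀ u w, inner ℝ (J u) w = -inner ℝ u (J w))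
    (hflow : IsRegularizedFlow α γ q s c p t₀ A J z dz W)
    (hpath : IsRegularizedPath c p R A J ζ dζ) :
    ∃ k C : ℝ, 0 < k ∧ ∀ᶠ t in atTop, ∃ e,
      HasDerivAt (energy (α - 1) γ q s c p φ J z ζ dz W) e t ∧
      e ≤ -(k * t ^ (-q)) * energy (α - 1) γ q s c p φ J z ζ dz W t
        + C * t ^ (-q - (2 - 4 * q - s - p)) := by
  have ha : 0 < α - 1 := by linarith
  set a := α - 1 with ha_def
  obtain ⟨k, hk0, hk1, hk2, hk3, hk4⟩ := exists_damping_rate hγ hc ha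
  refine ⟨k, 2 * ((2 * (‖J‖ + c) + a) * (p * R)) ^ 2 / (a * c) + (a * (p * R)) ^ 2 / (4 * k),
    hk0, ?_⟩
  filter_upwards [eventually_coeff_bounds γ s hγ hq0 hq1 hs hc hp1 ha h1,
    eventually_gt_atTop t₀] with t ⟨ht1, hη, hβ, hN, hN', hPSL, hτ⟩ ht
  have ht0 : 0 < t := by linarith
  have hP : 1 ≤ t ^ q := Real.one_le_rpow ht1 hq0.le
  have hS : 1 ≤ t ^ s := Real.one_le_rpow ht1 hs.le
  have hL0 : 0 < t ^ (-p) := by positivity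
  have hL1 : t ^ (-p) ≤ 1 := Real.rpow_le_one_of_one_le_of_nonpos ht1 (by linarith)
  have hβ0 : 0 < betaCoeff γ q s t := lt_of_lt_of_le (by positivity) hβ
  have hN0 : 0 ≤ gapWeight γ q s t := le_trans (by positivity) hN.1
  have hl : c / t ^ p = c * t ^ (-p) := by rw [Real.rpow_neg ht0.le, div_eq_mul_inv]
  have hζ := hpath.zero t ht0
  refine ⟨_, hasDerivAt_energy hα ht0 hJ hφ hflow hpath ht hβ0, ?_⟩
  have hG := le_gap hconv hφ hJ hζ (z := z t)
  have hG' := gap_add_le hconv hφ hJ hζ (z := z t)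
  have hG0 : 0 ≤ gap φ J (c / t ^ p) (z t) (ζ t) := le_trans (by positivity) hG
  rw [energy, ← ha_def]
  -- The error power `P³ S τ² / L` of `energy_absorption`, and the origin of the exponent `2 - 4q -
  -- s - p`.
  have hrate : t ^ (-q - (2 - 4 * q - s - p)) = (t ^ q) ^ 3 * t ^ s * t⁻¹ ^ 2 / t ^ (-p) := by
    rw [← Real.rpow_neg_one, ← Real.rpow_natCast (t ^ q), ← Real.rpow_natCast (t ^ (-1 : ℝ)),
      ← Real.rpow_mul ht0.le, ← Real.rpow_mul ht0.le, ← Real.rpow_add ht0, ← Real.rpow_add ht0,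
      ← Real.rpow_sub ht0]
    norm_num
    ring_nf
  rw [hrate, Real.rpow_neg ht0.le q]
  have hdζ := hpath.norm_deriv_le t ht0
  have hζR := hpath.norm_le t ht0
  set δ := ‖z t - ζ t‖ with hδ
  have hδ0 : 0 ≤ δ := norm_nonneg _
  have hτ0 : 0 < t⁻¹ := by positivity
  have hpR : 0 ≤ p * R * t⁻¹ := by positivity
  refine energy_absorption (j := ‖J‖) (R := R) (p := p) (ω := ‖dz t‖) (ν := ‖W t‖) ha hγ hc hp0
    hR (norm_nonneg J) hk0 hk1 hk2 hk3 hk4 hP hS hL0 hL1 hτ0 hη hβ ⟨hN0, hN.2⟩ hN' hPSL hτ hδ0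
    (norm_nonneg (mixed a γ q z ζ dz W t)) ?_ hG0 ?_
  · rw [mixed]
    refine (norm_add_le _ _).trans ?_
    rw [norm_smul, norm_smul, Real.norm_of_nonneg ha.le, Real.norm_of_nonneg (by linarith)]
    have h2 : ‖dz t + γ • W t‖ ≤ ‖dz t‖ + γ * ‖W t‖ := by
      refine (norm_add_le _ _).trans ?_
      rw [norm_smul, Real.norm_of_nonneg hγ.le]
    have h3 := mul_le_mul_of_nonneg_left h2 (show 0 ≤ t ^ q by linarith)
    linarith
  · have k1 := mul_le_mul_of_nonneg_left hG' (show 0 ≤ a * betaCoeff γ q s t by positivity)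
    have k2 : inner ℝ (J (dζ t)) (z t - ζ t) ≤ ‖J‖ * (p * R * t⁻¹) * δ := by
      refine (real_inner_le_norm _ _).trans (mul_le_mul_of_nonneg_right ?_ hδ0)
      exact (J.le_opNorm _).trans (mul_le_mul_of_nonneg_left hdζ (norm_nonneg _))
    -- Expanding around `ζ`, the quadratic part `δ²` has the good sign and is dropped, so no a
    -- priori bound on `z` is needed.
    have k3 : -(c * p * t ^ (-p) * t⁻¹ / 2 * (‖z t‖ ^ 2 - ‖ζ t‖ ^ 2)) ≤ c * (p * R * t⁻¹) * δ := by
      have e1 : ‖z t‖ ^ 2 - ‖ζ t‖ ^ 2 = δ ^ 2 + 2 * inner ℝ (z t - ζ t) (ζ t) := by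
        rw [hδ, norm_sub_sq_real, inner_sub_left, real_inner_self_eq_norm_sq]
        ring
      have e2 : -(δ * R) ≤ inner ℝ (z t - ζ t) (ζ t) := by
        have := neg_le_of_abs_le (abs_real_inner_le_norm (z t - ζ t) (ζ t))
        have := mul_le_mul_of_nonneg_left hζR hδ0
        linarith
      have e3 : -(2 * (δ * R)) ≤ ‖z t‖ ^ 2 - ‖ζ t‖ ^ 2 := by
        rw [e1]
        linarith [sq_nonneg δ]
      have e4 := mul_le_mul_of_nonneg_left e3
        (show 0 ≤ c * p * t ^ (-p) * t⁻¹ / 2 by positivity)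
      have e5 := mul_le_mul_of_nonneg_left hL1 (show 0 ≤ c * (p * R * t⁻¹) * δ by positivity)
      linarith
    have k4 : gapWeight γ q s t * (inner ℝ (J (dζ t)) (z t - ζ t)
          - c * p * t ^ (-p) * t⁻¹ / 2 * (‖z t‖ ^ 2 - ‖ζ t‖ ^ 2))
        ≤ gapWeight γ q s t * ((‖J‖ + c) * (p * R * t⁻¹) * δ) :=
      mul_le_mul_of_nonneg_left (by linarith) hN0
    have k5 : -(a * etaCoeff q t * inner ℝ (z t - ζ t) (dζ t)) ≤ a * (p * R * t⁻¹) * δ := by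
      have e1 := neg_le_of_abs_le (abs_real_inner_le_norm (z t - ζ t) (dζ t))
      have e2 := mul_le_mul_of_nonneg_left hdζ hδ0
      have e3 : -inner ℝ (z t - ζ t) (dζ t) ≤ δ * (p * R * t⁻¹) := by linarith
      have hη0 : 0 ≤ etaCoeff q t := le_trans (by norm_num) hη.1
      have e4 := mul_le_mul_of_nonneg_left e3 (show 0 ≤ a * etaCoeff q t by positivity)
      have e5 := mul_le_mul_of_nonneg_left hη.2
        (show 0 ≤ a * (δ * (p * R * t⁻¹)) by positivity)
      linarith
    have k6 : a / 2 * (q * (1 - q) * t ^ (q - 2)) * δ ^ 2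
        ≤ a / 2 * (t ^ q * t⁻¹ ^ 2) * δ ^ 2 := by
      have e1 : t ^ (q - 2) = t ^ q * t⁻¹ ^ 2 := by
        rw [Real.rpow_sub ht0, inv_pow, ← Real.rpow_two, div_eq_mul_inv]
      rw [e1]
      have e2 : q * (1 - q) ≤ 1 := by linarith [mul_nonneg hq0.le hq0.le]
      have := mul_le_mul_of_nonneg_right e2
        (show 0 ≤ a / 2 * (t ^ q * t⁻¹ ^ 2) * δ ^ 2 by positivity)
      linarith
    have k7 : -(a * inner ℝ (mixed a γ q z ζ dz W t) (dζ t))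
        ≤ a * (p * R * t⁻¹) * ‖mixed a γ q z ζ dz W t‖ := by
      have e1 := neg_le_of_abs_le (abs_real_inner_le_norm (mixed a γ q z ζ dz W t) (dζ t))
      have e2 := mul_le_mul_of_nonneg_left hdζ (norm_nonneg (mixed a γ q z ζ dz W t))
      have e3 : -inner ℝ (mixed a γ q z ζ dz W t) (dζ t)
          ≤ ‖mixed a γ q z ζ dz W t‖ * (p * R * t⁻¹) := by linarith
      have := mul_le_mul_of_nonneg_left e3 ha.le
      linarith
    rw [← hl]
    linarith

/-- Eventually `η ≥ 1/2`, so the energy dominates `((α - 1) / 4) ‖z - ζ‖²`; the square root halves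
its decay exponent. -/
theorem norm_sub_path_isBigO (hα : 1 < α) (hγ : 0 < γ) (hq0 : 0 < q) (hq1 : q < 1)
    (hs : 0 < s) (hc : 0 < c) (hp0 : 0 < p) (hp1 : p < 1) (h1 : p - 2 * q - s < 0)
    (hR : 0 ≤ R) (hconv : ConvexOn ℝ univ φ) (hφ : ∀ z, HasGradientAt φ (A z) z)
    (hJ : ∀ u w, inner ℝ (J u) w = -inner ℝ u (J w))
    (hflow : IsRegularizedFlow α γ q s c p t₀ A J z dz W)
    (hpath : IsRegularizedPath c p R A J ζ dζ) :
    ∃ D, 0 ≤ D ∧ ∀ᶠ t in atTop, ‖z t - ζ t‖ ≤ D * t ^ (-(1 - 2 * q - (s + p) / 2)) := by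
  obtain ⟨k, C, hk, hE⟩ := eventually_energy_deriv_le hα hγ hq0 hq1 hs hc hp0 hp1 h1 hR hconv hφ
    hJ hflow hpath
  obtain ⟨M, hM0, hM⟩ := eventually_le_rpow_of_deriv_le hk hq1 hE
  have ha : 0 < α - 1 := by linarith
  refine ⟨√(4 * M / (α - 1)), Real.sqrt_nonneg _, ?_⟩
  filter_upwards [hM, eventually_coeff_bounds γ s hγ hq0 hq1 hs hc hp1 ha h1]
    with t htM ⟨ht1, hη, hβ, hN, _⟩
  have ht0 : 0 < t := by linarith
  have hN0 : 0 ≤ gapWeight γ q s t := le_trans (by positivity) hN.1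
  have hG0 : 0 ≤ gap φ J (c / t ^ p) (z t) (ζ t) :=
    le_trans (by positivity) (le_gap hconv hφ hJ (hpath.zero t ht0) (z := z t))
  have h2 : (α - 1) / 4 * ‖z t - ζ t‖ ^ 2 ≤ M * t ^ (-(2 - 4 * q - s - p)) := by
    refine le_trans ?_ htM
    rw [energy]
    have e1 := mul_nonneg hN0 hG0
    have e2 := mul_le_mul_of_nonneg_right hη.1
      (show 0 ≤ (α - 1) / 2 * ‖z t - ζ t‖ ^ 2 by positivity)
    linarith [sq_nonneg ‖mixed (α - 1) γ q z ζ dz W t‖]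
  have h3 : t ^ (-(2 - 4 * q - s - p)) = (t ^ (-(1 - 2 * q - (s + p) / 2))) ^ 2 := by
    rw [← Real.rpow_natCast, ← Real.rpow_mul ht0.le]
    norm_num
    ring_nf
  refine le_of_sq_le_sq ?_ (by positivity)
  rw [mul_pow, Real.sq_sqrt (by positivity), ← h3, div_mul_eq_mul_div, le_div_iff₀ ha]
  linarith

theorem gap_zero_nonneg (hconv : ConvexOn ℝ univ φ) (hφ : ∀ z, HasGradientAt φ (A z) z)
    (hJ : ∀ u w, inner ℝ (J u) w = -inner ℝ u (J w)) {zbar : Z} (hbar : A zbar + J zbar = 0)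
    (w : Z) : 0 ≤ gap φ J 0 w zbar := by
  have := le_gap (l := 0) (z := w) hconv hφ hJ (by rw [zero_smul, add_zero]; exact hbar)
  simpa using this

/-- Convexity at `ζ` and the equation for `ζ` bound the gap by `(c / t^p) ⟨ζ, zbar - ζ⟩`. -/
theorem gap_zero_path_le (hc : 0 < c) (hconv : ConvexOn ℝ univ φ)
    (hφ : ∀ z, HasGradientAt φ (A z) z) (hJ : ∀ u w, inner ℝ (J u) w = -inner ℝ u (J w))
    {zbar : Z} (hpath : IsRegularizedPath c p ‖zbar‖ A J ζ dζ) {t : ℝ} (ht : 0 < t) :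
    gap φ J 0 (ζ t) zbar ≤ c * ‖zbar‖ ^ 2 * (1 / t ^ p) := by
  have h1 := hconv.add_inner_gradient_le hφ (ζ t) zbar
  have hA : A (ζ t) = -J (ζ t) - (c / t ^ p) • ζ t := by
    rw [← sub_eq_zero, ← hpath.zero t ht]
    abel
  have h0 : inner ℝ (J (ζ t)) (ζ t) = 0 := by
    have := hJ (ζ t) (ζ t)
    rw [real_inner_comm (J (ζ t))] at this
    linarith
  rw [hA, inner_sub_left, inner_neg_left, real_inner_smul_left, inner_sub_right, h0, hJ (ζ t) zbar,
    inner_sub_right, real_inner_self_eq_norm_sq, real_inner_comm (J zbar)] at h1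
  have h2 : inner ℝ (ζ t) zbar ≤ ‖zbar‖ ^ 2 := by
    refine (real_inner_le_norm _ _).trans ?_
    rw [pow_two]
    exact mul_le_mul_of_nonneg_right (hpath.norm_le t ht) (norm_nonneg _)
  have hl : 0 < c / t ^ p := by positivity
  have h3 := mul_le_mul_of_nonneg_left
    (show inner ℝ (ζ t) zbar - ‖ζ t‖ ^ 2 ≤ ‖zbar‖ ^ 2 by linarith [sq_nonneg ‖ζ t‖]) hl.le
  rw [gap, show c * ‖zbar‖ ^ 2 * (1 / t ^ p) = c / t ^ p * ‖zbar‖ ^ 2 by ring]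
  linarith

theorem gap_zero_isBigO [FiniteDimensional ℝ Z] (hα : 1 < α) (hγ : 0 < γ) (hq0 : 0 < q)
    (hq1 : q < 1) (hs : 0 < s) (hc : 0 < c) (hp0 : 0 < p) (hp1 : p < 1)
    (h1 : p - 2 * q - s < 0) (h2 : 4 * q + s + p - 2 < 0)
    (hconv : ConvexOn ℝ univ φ) (hφ : ∀ z, HasGradientAt φ (A z) z) (hA : ContDiff ℝ 1 A)
    (hJ : ∀ u w, inner ℝ (J u) w = -inner ℝ u (J w))
    (hflow : IsRegularizedFlow α γ q s c p t₀ A J z dz W)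
    {zbar : Z} (hbar : A zbar + J zbar = 0) :
    (fun t => gap φ J 0 (z t) zbar)
      =O[atTop] fun t : ℝ => 1 / t ^ (1 - 2 * q - (s + p) / 2) + 1 / t ^ p := by
  obtain ⟨ζ, dζ, hpath⟩ := exists_isRegularizedPath hc hp0 hA
    (inner_gradient_sub_nonneg hconv hφ) hJ hbar
  obtain ⟨D, hD0, hD⟩ := norm_sub_path_isBigO hα hγ hq0 hq1 hs hc hp0 hp1 h1 (norm_nonneg zbar)
    hconv hφ hJ hflow hpath
  have : ProperSpace Z := FiniteDimensional.proper ℝ Z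
  -- By `h2` the rate exponent is positive, so the trajectory eventually stays in this ball. There
  -- `B` bounds the gradient of the gap.
  obtain ⟨B, hB⟩ := (isCompact_closedBall (0 : Z) (‖zbar‖ + D)).exists_bound_of_continuousOn
    (f := fun w => A w + J zbar) (hA.continuous.add continuous_const).continuousOn
  have hB0 : 0 ≤ B := (norm_nonneg _).trans
    (hB 0 (Metric.mem_closedBall_self (by positivity)))
  refine IsBigO.of_bound (B * D + c * ‖zbar‖ ^ 2) ?_
  filter_upwards [hD, eventually_ge_atTop 1] with t htD ht1
  have ht0 : 0 < t := by linarith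
  have hrate : t ^ (-(1 - 2 * q - (s + p) / 2)) = 1 / t ^ (1 - 2 * q - (s + p) / 2) := by
    rw [Real.rpow_neg ht0.le, one_div]
  have hle1 : t ^ (-(1 - 2 * q - (s + p) / 2)) ≤ 1 :=
    Real.rpow_le_one_of_one_le_of_nonpos ht1 (by linarith)
  have hz : z t ∈ Metric.closedBall (0 : Z) (‖zbar‖ + D) := by
    rw [mem_closedBall_zero_iff]
    have e1 : ‖z t‖ ≤ ‖ζ t‖ + ‖z t - ζ t‖ := by
      have := norm_add_le (ζ t) (z t - ζ t)
      rwa [add_sub_cancel] at this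
    have e2 := hpath.norm_le t ht0
    have e3 := mul_le_mul_of_nonneg_left hle1 hD0
    linarith
  have hdiff : gap φ J 0 (z t) zbar ≤ gap φ J 0 (ζ t) zbar + B * ‖z t - ζ t‖ := by
    have e1 := hconv.add_inner_gradient_le hφ (z t) (ζ t)
    have e2 : inner ℝ (A (z t) + J zbar) (z t - ζ t) ≤ B * ‖z t - ζ t‖ :=
      (real_inner_le_norm _ _).trans (mul_le_mul_of_nonneg_right (hB _ hz) (norm_nonneg _))
    rw [← neg_sub (z t), inner_neg_right] at e1
    rw [inner_add_left, inner_sub_right (J zbar)] at e2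
    rw [gap, gap]
    linarith
  have hpathle := gap_zero_path_le hc hconv hφ hJ hpath ht0
  have hnn := gap_zero_nonneg hconv hφ hJ hbar (z t)
  rw [Real.norm_of_nonneg hnn, Real.norm_of_nonneg (by positivity)]
  rw [hrate] at htD
  have e1 := mul_le_mul_of_nonneg_left htD hB0
  have e2 : 0 ≤ B * D * (1 / t ^ p) := by positivity
  have e3 : 0 ≤ c * ‖zbar‖ ^ 2 * (1 / t ^ (1 - 2 * q - (s + p) / 2)) := by positivity
  linarith

end SaddleFlow

/-! ### Translation of the saddle system to the product space. -/

namespace SaddleFlow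

section Gradient

variable {E : Type*} [NormedAddCommGroup E] [InnerProductSpace ℝ E] [CompleteSpace E]

theorem hasGradientAt_of_contDiff_two {f : E → ℝ} (hf : ContDiff ℝ 2 f) (x : E) :
    HasGradientAt f (gradient f x) x :=
  ((hf.differentiable two_ne_zero) x).hasGradientAt

theorem contDiff_gradient {f : E → ℝ} (hf : ContDiff ℝ 2 f) : ContDiff ℝ 1 (gradient f) :=
  (InnerProductSpace.toDual ℝ E).symm.contDiff.comp (hf.fderiv_right (by norm_num))

end Gradient

section Product

variable {E F : Type*} [NormedAddCommGroup E] [InnerProductSpace ℝ E]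
  [NormedAddCommGroup F] [InnerProductSpace ℝ F]

theorem convexOn_pair {f : E → ℝ} {g : F → ℝ} (hf : ConvexOn ℝ univ f)
    (hg : ConvexOn ℝ univ g) :
    ConvexOn ℝ univ (fun z : WithLp 2 (E × F) => f z.fst + g z.snd) := by
  refine ⟨convex_univ, fun z _ w _ a b ha hb hab => ?_⟩
  have h1 := hf.2 (mem_univ z.fst) (mem_univ w.fst) ha hb hab
  have h2 := hg.2 (mem_univ z.snd) (mem_univ w.snd) ha hb hab
  simp only [WithLp.add_fst, WithLp.smul_fst, WithLp.add_snd, WithLp.smul_snd, smul_eq_mul] at *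
  linarith

theorem hasDerivAt_toLp_prod {u : ℝ → E} {v : ℝ → F} {u' : E} {v' : F} {t : ℝ}
    (hu : HasDerivAt u u' t) (hv : HasDerivAt v v' t) :
    HasDerivAt (fun t => WithLp.toLp 2 (u t, v t)) (WithLp.toLp 2 (u', v')) t :=
  (WithLp.prodContinuousLinearEquiv 2 ℝ E F).symm.hasFDerivAt.comp_hasDerivAt t
    (hu.prodMk hv)

variable [CompleteSpace E] [CompleteSpace F]

/-- The pair of gradients of `f` and `g`. -/
noncomputable def pairGradient (f : E → ℝ) (g : F → ℝ) (z : WithLp 2 (E × F)) :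
    WithLp 2 (E × F) :=
  WithLp.toLp 2 (gradient f z.fst, gradient g z.snd)

/-- The skew map `(x, y) ↦ (K† y, -K x)`. -/
noncomputable def skewMap (K : E →L[ℝ] F) : WithLp 2 (E × F) →L[ℝ] WithLp 2 (E × F) :=
  ((WithLp.prodContinuousLinearEquiv 2 ℝ E F).symm : E × F →L[ℝ] WithLp 2 (E × F)) ∘L
    (((ContinuousLinearMap.adjoint K) ∘L ContinuousLinearMap.snd ℝ E F).prod
      (-(K ∘L ContinuousLinearMap.fst ℝ E F))) ∘L
    (WithLp.prodContinuousLinearEquiv 2 ℝ E F : WithLp 2 (E × F) →L[ℝ] E × F)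

theorem skewMap_apply (K : E →L[ℝ] F) (z : WithLp 2 (E × F)) :
    skewMap K z = WithLp.toLp 2 (ContinuousLinearMap.adjoint K z.snd, -K z.fst) := rfl

theorem inner_skewMap (K : E →L[ℝ] F) (u w : WithLp 2 (E × F)) :
    inner ℝ (skewMap K u) w = -inner ℝ u (skewMap K w) := by
  rw [skewMap_apply, skewMap_apply, WithLp.prod_inner_apply, WithLp.prod_inner_apply]
  change inner ℝ (ContinuousLinearMap.adjoint K u.snd) w.fst + inner ℝ (-K u.fst) w.snd
    = -(inner ℝ u.fst (ContinuousLinearMap.adjoint K w.snd) + inner ℝ u.snd (-K w.fst))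
  rw [ContinuousLinearMap.adjoint_inner_left, ContinuousLinearMap.adjoint_inner_right,
    inner_neg_left, inner_neg_right]
  ring

theorem hasGradientAt_pair {f : E → ℝ} {g : F → ℝ} (hf : ContDiff ℝ 2 f) (hg : ContDiff ℝ 2 g)
    (z : WithLp 2 (E × F)) :
    HasGradientAt (fun z : WithLp 2 (E × F) => f z.fst + g z.snd) (pairGradient f g z) z := by
  have h1 := (hasGradientAt_of_contDiff_two hf z.fst).hasFDerivAt
  have h2 := (hasGradientAt_of_contDiff_two hg z.snd).hasFDerivAt
  have e := (WithLp.prodContinuousLinearEquiv 2 ℝ E F).hasFDerivAt (x := z)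
  have h3 := h1.comp z ((ContinuousLinearMap.fst ℝ E F).hasFDerivAt.comp z e)
  have h4 := h2.comp z ((ContinuousLinearMap.snd ℝ E F).hasFDerivAt.comp z e)
  refine (h3.add h4).congr_fderiv ?_
  ext w
  change inner ℝ (gradient f z.fst) w.fst + inner ℝ (gradient g z.snd) w.snd
    = inner ℝ (pairGradient f g z) w
  rw [WithLp.prod_inner_apply]
  rfl

theorem contDiff_pairGradient {f : E → ℝ} {g : F → ℝ} (hf : ContDiff ℝ 2 f)
    (hg : ContDiff ℝ 2 g) : ContDiff ℝ 1 (pairGradient f g) := by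
  have e : ContDiff ℝ 1 (WithLp.prodContinuousLinearEquiv 2 ℝ E F) :=
    (WithLp.prodContinuousLinearEquiv 2 ℝ E F).contDiff
  exact (WithLp.prodContinuousLinearEquiv 2 ℝ E F).symm.contDiff.comp
    (((contDiff_gradient hf).comp (contDiff_fst.comp e)).prodMk
      ((contDiff_gradient hg).comp (contDiff_snd.comp e)))

end Product

variable {n m : ℕ} {K : EuclideanSpace ℝ (Fin n) →L[ℝ] EuclideanSpace ℝ (Fin m)}
  {f : EuclideanSpace ℝ (Fin n) → ℝ} {g : EuclideanSpace ℝ (Fin m) → ℝ}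

theorem lagrangian_sub_lagrangian (x xbar : EuclideanSpace ℝ (Fin n))
    (y ybar : EuclideanSpace ℝ (Fin m)) :
    lagrangian K f g x ybar - lagrangian K f g xbar y
      = gap (fun z => f z.fst + g z.snd) (skewMap K) 0 (WithLp.toLp 2 (x, y))
          (WithLp.toLp 2 (xbar, ybar)) := by
  rw [gap, skewMap_apply, WithLp.prod_inner_apply, lagrangian, lagrangian]
  change _ = f x + g y - (f xbar + g ybar)
    + (inner ℝ (ContinuousLinearMap.adjoint K ybar) x + inner ℝ (-K xbar) y) + 0 / 2 * _
  rw [ContinuousLinearMap.adjoint_inner_left, inner_neg_left, real_inner_comm (K x) ybar]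
  ring

/-- Saddle points are the zeros of the saddle field. -/
theorem pairGradient_add_skewMap_eq_zero (hf : ContDiff ℝ 2 f) (hg : ContDiff ℝ 2 g)
    {zbar : WithLp 2 (EuclideanSpace ℝ (Fin n) × EuclideanSpace ℝ (Fin m))}
    (h : zbar ∈ saddleSet K f g) : pairGradient f g zbar + skewMap K zbar = 0 := by
  have hd : HasFDerivAt (fun z => f z.fst + g z.snd + inner ℝ (skewMap K zbar) z)
      (InnerProductSpace.toDual ℝ _ (pairGradient f g zbar)
        + InnerProductSpace.toDual ℝ _ (skewMap K zbar)) zbar :=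
    (hasGradientAt_pair hf hg zbar).hasFDerivAt.add
      (InnerProductSpace.toDual ℝ _ (skewMap K zbar)).hasFDerivAt
  -- Up to a constant this function is the primal-dual gap at `zbar`, which is nonnegative and
  -- vanishes at `zbar`.
  have hmin : IsLocalMin (fun z => f z.fst + g z.snd + inner ℝ (skewMap K zbar) z) zbar := by
    refine Eventually.of_forall fun w => ?_
    obtain ⟨h1, h2⟩ := h w.fst w.snd
    have h3 := lagrangian_sub_lagrangian (K := K) (f := f) (g := g) w.fst zbar.fst w.snd zbar.snd
    have h4 := lagrangian_sub_lagrangian (K := K) (f := f) (g := g)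
      zbar.fst zbar.fst zbar.snd zbar.snd
    change _ = gap _ _ 0 w zbar at h3
    change _ = gap _ _ 0 zbar zbar at h4
    rw [gap] at h3 h4
    dsimp only
    linarith
  have h0 := hmin.hasFDerivAt_eq_zero hd
  rw [← map_add] at h0
  exact (map_eq_zero_iff _ (InnerProductSpace.toDual ℝ _).injective).1 h0

theorem gradX_eq (hf : ContDiff ℝ 2 f) (c p t : ℝ) (x : EuclideanSpace ℝ (Fin n))
    (y : EuclideanSpace ℝ (Fin m)) :
    gradX c p K f g t x y
      = gradient f x + ContinuousLinearMap.adjoint K y + (c / t ^ p) • x := by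
  refine HasGradientAt.gradient ?_
  have h1 := (hasGradientAt_of_contDiff_two hf x).hasFDerivAt
  have h2 := (InnerProductSpace.toDual ℝ _ (ContinuousLinearMap.adjoint K y)).hasFDerivAt (x := x)
  have h3 := ((hasStrictFDerivAt_norm_sq x).hasFDerivAt.sub_const (‖y‖ ^ 2)).const_mul
    (c / (2 * t ^ p))
  have h4 := ((h1.add h2).sub_const (g y)).add h3
  have h5 : (fun x' => augLagrangian c p K f g t x' y)
      = fun x' => (f x' + InnerProductSpace.toDual ℝ _ (ContinuousLinearMap.adjoint K y) x' - g y)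
        + c / (2 * t ^ p) * (‖x'‖ ^ 2 - ‖y‖ ^ 2) := by
    funext x'
    rw [augLagrangian, lagrangian, InnerProductSpace.toDual_apply_apply,
      ContinuousLinearMap.adjoint_inner_left, real_inner_comm]
  rw [h5]
  refine h4.congr_fderiv ?_
  ext w
  simp
  ring

theorem gradY_eq (hg : ContDiff ℝ 2 g) (c p t : ℝ) (x : EuclideanSpace ℝ (Fin n))
    (y : EuclideanSpace ℝ (Fin m)) :
    gradY c p K f g t x y = -(gradient g y - K x + (c / t ^ p) • y) := by
  refine HasGradientAt.gradient ?_
  have h1 := (hasGradientAt_of_contDiff_two hg y).hasFDerivAt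
  have h2 := (InnerProductSpace.toDual ℝ _ (K x)).hasFDerivAt (x := y)
  have h3 := ((hasStrictFDerivAt_norm_sq y).hasFDerivAt.const_sub (‖x‖ ^ 2)).const_mul
    (c / (2 * t ^ p))
  have h4 := ((h2.const_add (f x)).sub h1).add h3
  refine h4.congr_fderiv ?_
  ext w
  simp
  ring

/-- The coefficient factors as `(t^(s+1) - γ q) t^(q-1)`, whence the threshold on `t₀`. -/
theorem betaCoeff_pos {γ q s t : ℝ} (hγ : 0 < γ) (hq : 0 < q) (hs : 0 < s) (ht : 0 < t)
    (h : (γ * q) ^ (1 / (s + 1)) < t) : 0 < betaCoeff γ q s t := by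
  have h1 : γ * q < t ^ (s + 1) := by
    have h2 := Real.rpow_lt_rpow (by positivity) h (show 0 < s + 1 by linarith)
    rwa [← Real.rpow_mul (by positivity), one_div_mul_cancel (by linarith), Real.rpow_one] at h2
  have h2 : t ^ (q + s) = t ^ (s + 1) * t ^ (q - 1) := by
    rw [← Real.rpow_add ht]; ring_nf
  rw [betaCoeff, h2, ← sub_mul]
  exact mul_pos (by linarith) (by positivity)

theorem differentiableAt_theta {α γ q s t : ℝ} (hα : 1 < α) (ht : 0 < t)
    (hβ : 0 < betaCoeff γ q s t) : DifferentiableAt ℝ (theta α γ q s) t := by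
  have h1 : DifferentiableAt ℝ (gapWeight γ q s) t := (hasDerivAt_gapWeight ht).differentiableAt
  have h2 : DifferentiableAt ℝ (betaCoeff γ q s) t :=
    (Real.hasDerivAt_rpow_const (Or.inl ht.ne')).differentiableAt.sub
      ((Real.hasDerivAt_rpow_const (Or.inl ht.ne')).differentiableAt.const_mul _)
  exact h1.div (h2.const_mul (α - 1)) (mul_pos (by linarith) hβ).ne'

theorem IsGlobalSolution.isRegularizedFlow {α γ q s c p t₀ : ℝ}
    {x : ℝ → EuclideanSpace ℝ (Fin n)} {y : ℝ → EuclideanSpace ℝ (Fin m)}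
    (h : IsGlobalSolution α γ q s c p t₀ K f g x y) (hf : ContDiff ℝ 2 f) (hg : ContDiff ℝ 2 g)
    (hα : 1 < α) (hγ : 0 < γ) (hq : 0 < q) (hs : 0 < s) (ht₀ : 0 < t₀)
    (ht₀' : (γ * q) ^ (1 / (s + 1)) < t₀) :
    IsRegularizedFlow α γ q s c p t₀ (pairGradient f g) (skewMap K)
      (fun t => WithLp.toLp 2 (x t, y t))
      (fun t => WithLp.toLp 2 (derivWithin x (Ici t₀) t, derivWithin y (Ici t₀) t))
      (fun t => WithLp.toLp 2
        (gradX c p K f g t (x t) (y t + theta α γ q s t • derivWithin y (Ici t₀) t),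
          -gradY c p K f g t (x t + theta α γ q s t • derivWithin x (Ici t₀) t) (y t))) := by
  have hnhds : ∀ t, t₀ < t → Ici t₀ ∈ 𝓝 t := fun t ht => Ici_mem_nhds ht
  have hx : ∀ t, t₀ < t → HasDerivAt x (derivWithin x (Ici t₀) t) t := fun t ht =>
    (h.diff_x t ht.le).hasDerivWithinAt.hasDerivAt (hnhds t ht)
  have hy : ∀ t, t₀ < t → HasDerivAt y (derivWithin y (Ici t₀) t) t := fun t ht =>
    (h.diff_y t ht.le).hasDerivWithinAt.hasDerivAt (hnhds t ht)
  have hdx : ∀ t, t₀ < t → HasDerivAt (derivWithin x (Ici t₀))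
      (derivWithin (derivWithin x (Ici t₀)) (Ici t₀) t) t := fun t ht =>
    (h.diff_dx t ht.le).hasDerivWithinAt.hasDerivAt (hnhds t ht)
  have hdy : ∀ t, t₀ < t → HasDerivAt (derivWithin y (Ici t₀))
      (derivWithin (derivWithin y (Ici t₀)) (Ici t₀) t) t := fun t ht =>
    (h.diff_dy t ht.le).hasDerivWithinAt.hasDerivAt (hnhds t ht)
  have hθ : ∀ t, t₀ < t → DifferentiableAt ℝ (theta α γ q s) t := fun t ht =>
    differentiableAt_theta hα (ht₀.trans ht)
      (betaCoeff_pos hγ hq hs (ht₀.trans ht) (ht₀'.trans ht))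
  have hl : ∀ t, t₀ < t → DifferentiableAt ℝ (fun t : ℝ => c / t ^ p) t := fun t ht =>
    (hasDerivAt_div_rpow c p (ht₀.trans ht)).differentiableAt
  have hgf := (contDiff_gradient hf).differentiable one_ne_zero
  have hgg := (contDiff_gradient hg).differentiable one_ne_zero
  refine ⟨fun t ht => hasDerivAt_toLp_prod (hx t ht) (hy t ht), fun t ht => ?_, fun t ht => ?_⟩
  -- The `derivWithin` of the field in the system could be the default `0`. The gradients being `C¹`
  -- and `θ` differentiable make it a genuine derivative.
  · have dU : DifferentiableAt ℝ (fun τ => gradX c p K f g τ (x τ)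
        (y τ + theta α γ q s τ • derivWithin y (Ici t₀) τ)) t := by
      simp only [gradX_eq hf]
      exact (((hgf (x t)).comp t (hx t ht).differentiableAt).add
        ((ContinuousLinearMap.adjoint K).differentiableAt.comp t
          ((hy t ht).differentiableAt.add
            ((hθ t ht).smul (hdy t ht).differentiableAt)))).add
        ((hl t ht).smul (hx t ht).differentiableAt)
    have dV : DifferentiableAt ℝ (fun τ => gradY c p K f g τ
        (x τ + theta α γ q s τ • derivWithin x (Ici t₀) τ) (y τ)) t := by
      simp only [gradY_eq hg]
      exact ((((hgg (y t)).comp t (hy t ht).differentiableAt).sub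
        (K.differentiableAt.comp t
          ((hx t ht).differentiableAt.add
            ((hθ t ht).smul (hdx t ht).differentiableAt)))).add
        ((hl t ht).smul (hy t ht).differentiableAt)).neg
    have dU' := dU.differentiableWithinAt.hasDerivWithinAt.hasDerivAt (hnhds t ht)
    have dV' := dV.differentiableWithinAt.hasDerivWithinAt.hasDerivAt (hnhds t ht)
    refine (hasDerivAt_toLp_prod ((hdx t ht).add (dU'.const_smul γ))
      ((hdy t ht).add (dV'.neg.const_smul γ))).congr_deriv ?_
    have ex := h.eq_x t ht.le
    have ey := h.eq_y t ht.le
    refine WithLp.ofLp_injective 2 (Prod.ext ?_ ?_)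
    · change _ + γ • _ = -((α / t ^ q) • derivWithin x (Ici t₀) t) - t ^ s • _
      rw [← sub_eq_zero, ← ex]
      abel
    · change _ + γ • -_ = -((α / t ^ q) • derivWithin y (Ici t₀) t) - t ^ s • -_
      rw [← sub_eq_zero, ← ey, smul_neg, smul_neg]
      abel
  · rw [skewMap_apply, gradX_eq hf, gradY_eq hg, neg_neg]
    refine WithLp.ofLp_injective 2 (Prod.ext ?_ ?_)
    · rfl
    · change _ = gradient g (y t) + -K _ + _
      rw [← sub_eq_add_neg]
      rfl

end SaddleFlow

theorem corollary1 {n m : ℕ}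
    (K : EuclideanSpace ℝ (Fin n) →L[ℝ] EuclideanSpace ℝ (Fin m))
    (f : EuclideanSpace ℝ (Fin n) → ℝ) (g : EuclideanSpace ℝ (Fin m) → ℝ)
    (hf : ContDiff ℝ 2 f) (hfc : ConvexOn ℝ Set.univ f)
    (hg : ContDiff ℝ 2 g) (hgc : ConvexOn ℝ Set.univ g)
    (α γ q s c p t₀ : ℝ)
    (hα : 1 < α) (hγ : 0 < γ) (hq0 : 0 < q) (hq1 : q < 1) (hs : 0 < s) (hc : 0 < c)
    (ht₀ : 0 < t₀) (ht₀' : (γ * q) ^ (1 / (s + 1)) < t₀)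
    (hp0 : 0 < p) (hp1 : p < 1)
    (h1 : p - 2 * q - s < 0) (h2 : 4 * q + s + p - 2 < 0) (h3 : 3 * q + s - p - 1 < 0)
    (x : ℝ → EuclideanSpace ℝ (Fin n)) (y : ℝ → EuclideanSpace ℝ (Fin m))
    (hsol : SaddleFlow.IsGlobalSolution α γ q s c p t₀ K f g x y)
    (xbar : EuclideanSpace ℝ (Fin n)) (ybar : EuclideanSpace ℝ (Fin m))
    (hbar : WithLp.toLp 2 (xbar, ybar) ∈
      SaddleFlow.projZero (SaddleFlow.saddleSet K f g)) :
    (1 ≤ q + 2 * p →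
      (fun t : ℝ => SaddleFlow.lagrangian K f g (x t) ybar
          - SaddleFlow.lagrangian K f g xbar (y t))
        =O[atTop] (fun t : ℝ => 1 / t ^ (1 - 2 * q - (s + p) / 2) + 1 / t ^ p)) ∧
    (q + 2 * p < 1 →
      (fun t : ℝ => SaddleFlow.lagrangian K f g (x t) ybar
          - SaddleFlow.lagrangian K f g xbar (y t))
        =O[atTop] (fun t : ℝ =>
          1 / t ^ ((1 + p - s) / 2 - 3 / 2 * q) + 1 / t ^ p)) := by
  have hmain : (fun t : ℝ => SaddleFlow.lagrangian K f g (x t) ybar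
      - SaddleFlow.lagrangian K f g xbar (y t))
      =O[atTop] (fun t : ℝ => 1 / t ^ (1 - 2 * q - (s + p) / 2) + 1 / t ^ p) := by
    simp only [SaddleFlow.lagrangian_sub_lagrangian]
    exact SaddleFlow.gap_zero_isBigO hα hγ hq0 hq1 hs hc hp0 hp1 h1 h2
      (SaddleFlow.convexOn_pair hfc hgc) (SaddleFlow.hasGradientAt_pair hf hg)
      (SaddleFlow.contDiff_pairGradient hf hg) (SaddleFlow.inner_skewMap K)
      (hsol.isRegularizedFlow hf hg hα hγ hq0 hs ht₀ ht₀')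
      (SaddleFlow.pairGradient_add_skewMap_eq_zero hf hg hbar.1)
  -- The exponent of (i) exceeds that of (ii) by `(1 - q - 2p) / 2`, which is positive in the second
  -- regime.
  refine ⟨fun _ => hmain, fun hqp => hmain.trans (IsBigO.of_bound 1 ?_)⟩
  filter_upwards [eventually_ge_atTop 1] with t ht
  have ht0 : 0 < t := by linarith
  have h4 : t ^ ((1 + p - s) / 2 - 3 / 2 * q) ≤ t ^ (1 - 2 * q - (s + p) / 2) :=
    Real.rpow_le_rpow_of_exponent_le ht (by linarith)
  have h5 := one_div_le_one_div_of_le (by positivity) h4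
  rw [Real.norm_of_nonneg (by positivity), Real.norm_of_nonneg (by positivity), one_mul]
  linarith
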